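/- Let $p$ be a prime and let $(S,\mathcal F,\mathcal L)$ be a $p$-local compact group: $S$ is a discrete $p$-toral group, $\mathcal F$ is a saturated fusion system over $S$, and $\mathcal L$ is a centric linking system associated to $\mathcal F$, with projection functor $\pi\colon\mathcal L\to\mathcal F$. Let $P\le S$ be fully normalized in $\mathcal F$ and $\mathcal F$-centric, but not $\mathcal F$-radical. The normalizer $N_{\mathcal F}P$ has as objects the subgroups of $N_SP$; its morphisms $Q\to R$ are those $\varphi\in\mathrm{Hom}_{\mathcal F}(Q,R)$ that extend to some $\varphi'\in\mathrm{Hom}_{\mathcal F}(QP,RP)$ with $\varphi'(P)=P$. The category $N_{\mathcal L}P$ has as objects the $N_{\mathcal F}P$-centric subgroups of $N_SP$; its morphisms $Q\to R$ are those $\varphi\in\mathrm{Hom}_{\mathcal L}(QP,RP)$ with $\pi(\varphi)|_Q\in\mathrm{Hom}_{N_{\mathcal F}P}(Q,R)$ and $\pi(\varphi)(P)=P$. Let $P\downarrow_{\not\cong}N_{\mathcal L}P$ be the full subcategory of the undercategory $P\downarrow N_{\mathcal L}P$ on the morphisms $P\to Q$ that are not isomorphisms in $\mathcal L$. For $\alpha\in\mathrm{Aut}_{\mathcal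 F}(P)$ put $N_\alpha=\{y\in N_SP : \alpha c_y\alpha^{-1}\in\mathrm{Aut}_S(P)\}$, where $c_y$ is conjugation by $y$, and let $\widetilde P=\bigcap_{\alpha\in\mathrm{Aut}_{\mathcal F}(P)}N_\alpha$. Then: 1. $\widetilde P$ is the largest subgroup $Q$ with $P\le Q\le N_SP$ such that every $\alpha\in\mathrm{Aut}_{\mathcal F}(P)$ extends to a morphism $Q\to S$ of $\mathcal F$; 2. $\widetilde P$ properly contains $P$; 3. the geometric realizations of the nerves are homotopy equivalent, $|P\downarrow_{\not\cong}N_{\mathcal L}P|\simeq|\widetilde P\downarrow N_{\mathcal L}P|$; 4. the undercategory $\widetilde P\downarrow N_{\mathcal L}P$ has an initial object, and the realizations of both nerves are contractible. -/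

import Mathlib

open CategoryTheory

universe v u

/-! ### Discrete `p`-toral groups -/

/-- The Prüfer group `ℤ/p^∞`, as the group of complex roots of unity of `p`-power order. -/
abbrev PruferGroup (p : ℕ) : Type := CommGroup.primaryComponent ℂˣ p

/-- `G` is an extension of a finite `p`-group of order `s.2` by `(ℤ/p^∞)^(s.1)`. -/
def HasSize (p : ℕ) (G : Type u) [Group G] (s : ℕ × ℕ) : Prop :=
  ∃ (N : Subgroup G) (_ : N.Normal), Nonempty (N ≃* (Fin s.1 → PruferGroup p)) ∧
    Finite (G ⧸ N) ∧ IsPGroup p (G ⧸ N) ∧ Nat.card (G ⧸ N) = s.2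

/-- Discrete `p`-toral groups. -/
def IsDiscretePToral (p : ℕ) (G : Type u) [Group G] : Prop :=
  ∃ s : ℕ × ℕ, HasSize p G s

open Classical in
/-- The size `(rank, number of components)` of a discrete `p`-toral group, in the lexicographic
order. (It is unique, see `HasSize.unique`; the value for other groups is irrelevant.) -/
noncomputable def pSize (p : ℕ) (G : Type u) [Group G] : ℕ ×ₗ ℕ :=
  if h : ∃ s : ℕ × ℕ, HasSize p G s then toLex h.choose else toLex (0, 0)

theorem PruferGroup.exists_pow_eq (p : ℕ) [Fact p.Prime] (n : ℕ) (x : PruferGroup p) :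
    ∃ y : PruferGroup p, y ^ p ^ n = x := by
  have hp : p ≠ 0 := (Fact.out : p.Prime).ne_zero
  have hpn : p ^ n ≠ 0 := pow_ne_zero _ hp
  obtain ⟨z, hz⟩ := IsAlgClosed.exists_pow_nat_eq ((x : ℂˣ) : ℂ) (Nat.pos_of_ne_zero hpn)
  have hz0 : z ≠ 0 := by
    rintro rfl
    rw [zero_pow hpn] at hz
    exact (x : ℂˣ).ne_zero hz.symm
  have hu : (Units.mk0 z hz0) ^ p ^ n = (x : ℂˣ) := by
    ext
    simpa using hz
  obtain ⟨k, hk⟩ := x.2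
  refine ⟨⟨Units.mk0 z hz0, n + k, ?_⟩, ?_⟩
  · rw [pow_add, pow_mul, hu, hk]
  · ext1
    exact hu

theorem PruferGroup.card_torsion (p : ℕ) [Fact p.Prime] :
    Nat.card {x : PruferGroup p // x ^ p = 1} = p := by
  have hp : NeZero p := ⟨(Fact.out : p.Prime).ne_zero⟩
  have e : {x : PruferGroup p // x ^ p = 1} ≃ rootsOfUnity p ℂ :=
    { toFun := fun x => ⟨x.1.1, by
        have := congrArg Subtype.val x.2
        simpa [mem_rootsOfUnity] using this⟩
      invFun := fun x => ⟨⟨x.1, 1, by simpa using (mem_rootsOfUnity p x.1).1 x.2⟩, by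
        ext1
        exact (mem_rootsOfUnity p x.1).1 x.2⟩
      left_inv := fun _ => rfl
      right_inv := fun _ => rfl }
  rw [Nat.card_congr e]
  exact Complex.card_rootsOfUnity p

/-- The size of a discrete `p`-toral group is well defined. -/
theorem HasSize.unique {p : ℕ} [Fact p.Prime] {G : Type u} [Group G] {s t : ℕ × ℕ}
    (hs : HasSize p G s) (ht : HasSize p G t) : s = t := by
  have key : ∀ {s t : ℕ × ℕ} (N M : Subgroup G) [N.Normal] [M.Normal],
      Nonempty (N ≃* (Fin s.1 → PruferGroup p)) → Finite (G ⧸ M) → IsPGroup p (G ⧸ M) →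
      N ≤ M := by
    intro s t N M _ _ ⟨e⟩ hM hpM x hx
    obtain ⟨n, hn⟩ := IsPGroup.iff_card.1 hpM
    choose y hy using fun i => PruferGroup.exists_pow_eq p n (e ⟨x, hx⟩ i)
    have h1 : (e.symm y) ^ p ^ n = ⟨x, hx⟩ := by
      rw [← map_pow, MulEquiv.symm_apply_eq]
      funext i
      exact hy i
    have h2 : ((e.symm y : N) : G) ^ p ^ n = x := congrArg Subtype.val h1
    rw [← QuotientGroup.eq_one_iff, ← h2, QuotientGroup.mk_pow, ← hn]
    exact pow_card_eq_one'
  obtain ⟨N, hN, ⟨e⟩, hNf, hNp, hNc⟩ := hs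
  obtain ⟨M, hM, ⟨f⟩, hMf, hMp, hMc⟩ := ht
  obtain rfl : N = M := le_antisymm (key (s := s) (t := t) N M ⟨e⟩ hMf hMp)
    (key (s := t) (t := s) M N ⟨f⟩ hNf hNp)
  have hcard : ∀ k, Nat.card {x : Fin k → PruferGroup p // x ^ p = 1} = p ^ k := by
    intro k
    have e' : {x : Fin k → PruferGroup p // x ^ p = 1} ≃
        (Fin k → {x : PruferGroup p // x ^ p = 1}) :=
      { toFun := fun x i => ⟨x.1 i, congrFun x.2 i⟩
        invFun := fun x => ⟨fun i => (x i).1, funext fun i => (x i).2⟩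
        left_inv := fun _ => rfl
        right_inv := fun _ => rfl }
    rw [Nat.card_congr e', Nat.card_pi]
    simp [PruferGroup.card_torsion]
  let g := e.symm.trans f
  have hg : Nat.card {x : Fin s.1 → PruferGroup p // x ^ p = 1} =
      Nat.card {x : Fin t.1 → PruferGroup p // x ^ p = 1} := by
    refine Nat.card_congr (g.toEquiv.subtypeEquiv fun x => ?_)
    have : g.toEquiv x ^ p = 1 ↔ x ^ p = 1 := by
      change g x ^ p = 1 ↔ _
      rw [← map_pow, map_eq_one_iff g g.injective]
    exact this.symm
  rw [hcard, hcard] at hg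
  exact Prod.ext (Nat.pow_right_injective (Fact.out : p.Prime).two_le hg) (hNc.symm.trans hMc)

/-! ### Fusion systems -/

section Subgroups

variable {S : Type u} [Group S]

/-- The homomorphism `c_g : P → Q`, `x ↦ g x g⁻¹`, for `g ∈ S` with `g P g⁻¹ ≤ Q`. -/
def conjHom {P Q : Subgroup S} (g : S) (h : ∀ x ∈ P, g * x * g⁻¹ ∈ Q) : P →* Q :=
  ((MulAut.conj g).toMonoidHom.comp P.subtype).codRestrict Q fun x => h x x.2

/-- The image of `φ : P → Q`, as a subgroup of the ambient group `S`. -/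
def homImage {P Q : Subgroup S} (φ : P →* Q) : Subgroup S := φ.range.map Q.subtype

/-- The restriction of `φ : Q → R` to a subgroup `P ≤ Q`. -/
def homRestrict {P Q R : Subgroup S} (φ : Q →* R) (h : P ≤ Q) : P →* R :=
  φ.comp (Subgroup.inclusion h)

/-- `Aut_S(P)`: the automorphisms of `P` induced by conjugation by elements of `N_S(P)`. -/
def autS (P : Subgroup S) : Subgroup (MulAut P) := P.normalizerMonoidHom.range

/-- `Aut_P(P)`: the inner automorphisms of `P`. -/
def innerAut (P : Subgroup S) : Subgroup (MulAut P) := (MulAut.conj : P →* MulAut P).range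

instance innerAut_normal (P : Subgroup S) : (innerAut P).Normal := by
  refine ⟨?_⟩
  rintro _ ⟨x, rfl⟩ α
  refine ⟨α x, ?_⟩
  ext y
  simp [MulAut.conj_apply]

/-- For `φ : P → Q`, the group `N_φ` of those `g ∈ N_S(P)` with `φ c_g φ⁻¹ ∈ Aut_S(φ(P))`, i.e.
such that `φ ∘ c_g = c ∘ φ` for some `c ∈ Aut_S(φ(P))`. -/
def homExtensionGroup {P Q : Subgroup S} (φ : P →* Q) : Subgroup S :=
  Subgroup.map (Subgroup.normalizer (P : Set S)).subtype
    { carrier := {g | ∃ c ∈ autS (homImage φ), ∀ x : P,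
        ((φ (P.normalizerMonoidHom g x) : Q) : S) =
          c ⟨φ x, Subgroup.mem_map_of_mem Q.subtype ⟨x, rfl⟩⟩}
      one_mem' := ⟨1, one_mem _, fun x => by simp⟩
      mul_mem' := by
        rintro a b ⟨c, hc, hac⟩ ⟨d, hd, hbd⟩
        refine ⟨c * d, mul_mem hc hd, fun x => ?_⟩
        rw [map_mul, MulAut.mul_apply, hac, MulAut.mul_apply]
        congr 2
        exact Subtype.ext (hbd x)
      inv_mem' := by
        rintro a ⟨c, hc, hac⟩
        refine ⟨c⁻¹, inv_mem hc, fun x => ?_⟩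
        have h := hac (P.normalizerMonoidHom a⁻¹ x)
        rw [← MulAut.mul_apply, ← map_mul, mul_inv_cancel, map_one, MulAut.one_apply] at h
        have h2 : (⟨φ x, Subgroup.mem_map_of_mem Q.subtype ⟨x, rfl⟩⟩ : homImage φ) =
            c ⟨φ (P.normalizerMonoidHom a⁻¹ x),
              Subgroup.mem_map_of_mem Q.subtype ⟨_, rfl⟩⟩ := Subtype.ext h
        rw [h2, MulAut.inv_apply_self] }

/-- For `α ∈ Aut(P)`, the group `N_α` of those `y ∈ N_S(P)` with `α c_y α⁻¹ ∈ Aut_S(P)`. -/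
def autExtensionGroup (P : Subgroup S) (α : MulAut P) : Subgroup S :=
  Subgroup.map (Subgroup.normalizer (P : Set S)).subtype
    ((autS P).comap ((MulAut.conj α).toMonoidHom.comp P.normalizerMonoidHom))

theorem mem_autExtensionGroup {P : Subgroup S} {α : MulAut P} {y : S} :
    y ∈ autExtensionGroup P α ↔ ∃ hy : y ∈ Subgroup.normalizer (P : Set S),
      α * P.normalizerMonoidHom ⟨y, hy⟩ * α⁻¹ ∈ autS P := by
  simp [autExtensionGroup, Subgroup.mem_map, MulAut.conj_apply]

end Subgroups

/-- A fusion system over `S`: a category whose objects are the subgroups of `S` and whose morphisms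
are injective group homomorphisms, containing all the homomorphisms `c_g` with `g ∈ S` (in
particular all identities and inclusions), and such that each morphism is an isomorphism of the
category followed by an inclusion. -/
structure FusionSystem (S : Type u) [Group S] where
  /-- The morphisms `P → Q`. -/
  Hom : (P Q : Subgroup S) → Set (P →* Q)
  injective : ∀ {P Q : Subgroup S} {φ : P →* Q}, φ ∈ Hom P Q → Function.Injective φ
  comp_mem : ∀ {P Q R : Subgroup S} {φ : P →* Q} {ψ : Q →* R},
    φ ∈ Hom P Q → ψ ∈ Hom Q R → ψ.comp φ ∈ Hom P R
  conj_mem : ∀ {P Q : Subgroup S} (g : S) (h : ∀ x ∈ P, g * x * g⁻¹ ∈ Q), conjHom g h ∈ Hom P Q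
  factor : ∀ {P Q : Subgroup S} {φ : P →* Q}, φ ∈ Hom P Q →
    ∃ (R : Subgroup S) (h : R ≤ Q) (e : P ≃* R), e.toMonoidHom ∈ Hom P R ∧
      e.symm.toMonoidHom ∈ Hom R P ∧ φ = (Subgroup.inclusion h).comp e.toMonoidHom

namespace FusionSystem

variable {S : Type u} [Group S] (F : FusionSystem S)

theorem inclusion_mem {P Q : Subgroup S} (h : P ≤ Q) : Subgroup.inclusion h ∈ F.Hom P Q := by
  convert F.conj_mem (P := P) (Q := Q) 1 (fun x hx => by simpa using h hx)
  ext x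
  simp [conjHom]

theorem id_mem (P : Subgroup S) : MonoidHom.id P ∈ F.Hom P P := F.inclusion_mem le_rfl

/-- `P` and `Q` are isomorphic objects of `F`. -/
def IsConj (P Q : Subgroup S) : Prop :=
  ∃ e : P ≃* Q, e.toMonoidHom ∈ F.Hom P Q ∧ e.symm.toMonoidHom ∈ F.Hom Q P

/-- `P` is fully centralized in `F`. -/
def IsFullyCentralized (p : ℕ) (P : Subgroup S) : Prop :=
  ∀ Q : Subgroup S, F.IsConj P Q →
    pSize p (Subgroup.centralizer (Q : Set S)) ≤ pSize p (Subgroup.centralizer (P : Set S))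

/-- `P` is fully normalized in `F`. -/
def IsFullyNormalized (p : ℕ) (P : Subgroup S) : Prop :=
  ∀ Q : Subgroup S, F.IsConj P Q →
    pSize p (Subgroup.normalizer (Q : Set S)) ≤ pSize p (Subgroup.normalizer (P : Set S))

/-- `Aut_F(P)`: the automorphisms of the object `P` of `F`. -/
def aut (P : Subgroup S) : Subgroup (MulAut P) where
  carrier := {α | α.toMonoidHom ∈ F.Hom P P ∧ α.symm.toMonoidHom ∈ F.Hom P P}
  one_mem' := ⟨F.id_mem P, F.id_mem P⟩
  mul_mem' ha hb := ⟨F.comp_mem hb.1 ha.1, F.comp_mem ha.2 hb.2⟩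
  inv_mem' ha := ⟨ha.2, ha.1⟩

/-- `Out_F(P) = Aut_F(P) / Aut_P(P)`. -/
abbrev Out (P : Subgroup S) : Type u := F.aut P ⧸ (innerAut P).subgroupOf (F.aut P)

/-- `Out_S(P) = Aut_S(P) / Aut_P(P)`, as a subgroup of `Out_F(P)`. -/
def outS (P : Subgroup S) : Subgroup (F.Out P) :=
  ((autS P).subgroupOf (F.aut P)).map (QuotientGroup.mk' _)

/-- Saturation of a fusion system over a discrete `p`-toral group: the Sylow condition on fully
normalized subgroups, the extension of each `φ` with fully centralized image to `N_φ`, and closure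
under unions of increasing sequences of subgroups. -/
structure IsSaturated (p : ℕ) : Prop where
  sylow : ∀ P : Subgroup S, F.IsFullyNormalized p P → F.IsFullyCentralized p P ∧
    Finite (F.Out P) ∧ ∃ T : Sylow p (F.Out P), (T : Subgroup (F.Out P)) = F.outS P
  extend : ∀ (P : Subgroup S), ∀ φ ∈ F.Hom P ⊤, F.IsFullyCentralized p (homImage φ) →
    ∃ ψ ∈ F.Hom (homExtensionGroup φ) ⊤, ∃ h : P ≤ homExtensionGroup φ, homRestrict ψ h = φ
  union : ∀ P : ℕ → Subgroup S, Monotone P →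
    ∀ φ : (⨆ n, P n : Subgroup S) →* (⊤ : Subgroup S),
      (∀ n, homRestrict φ (le_iSup P n) ∈ F.Hom (P n) ⊤) → φ ∈ F.Hom (⨆ n, P n) ⊤

/-- `P` is `F`-centric: each `F`-conjugate of `P` (including `P`) contains its centralizer. -/
def IsCentric (P : Subgroup S) : Prop :=
  ∀ Q : Subgroup S, F.IsConj P Q → Subgroup.centralizer (Q : Set S) ≤ Q

/-- `P` is `F`-radical: `Out_F(P)` has no nontrivial normal `p`-subgroup. -/
def IsRadical (p : ℕ) (P : Subgroup S) : Prop :=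
  ∀ N : Subgroup (F.Out P), N.Normal → IsPGroup p N → N = ⊥

variable {F} in
/-- A subgroup containing an `F`-centric subgroup is `F`-centric. -/
theorem IsCentric.of_le {P Q : Subgroup S} (hP : F.IsCentric P) (h : P ≤ Q) : F.IsCentric Q := by
  rintro R ⟨e, he, -⟩
  obtain ⟨R', hR', e', he', he'', -⟩ := F.factor (F.comp_mem (F.inclusion_mem h) he)
  exact (Subgroup.centralizer_le (SetLike.coe_subset_coe.2 hR')).trans
    ((hP R' ⟨e', he', he''⟩).trans hR')

/-- The subgroup `P̃` of `N_S(P)`: the intersection of the groups `N_α` for `α ∈ Aut_F(P)`. -/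
def tilde (P : Subgroup S) : Subgroup S := ⨅ α ∈ F.aut P, autExtensionGroup P α

theorem tilde_le_normalizer (P : Subgroup S) :
    F.tilde P ≤ Subgroup.normalizer (P : Set S) := by
  intro y hy
  have h : y ∈ autExtensionGroup P 1 := by
    simp only [tilde, Subgroup.mem_iInf] at hy
    exact hy 1 (one_mem _)
  exact (mem_autExtensionGroup.1 h).1

theorem le_tilde (P : Subgroup S) : P ≤ F.tilde P := by
  intro y hy
  simp only [tilde, Subgroup.mem_iInf]
  intro α _
  refine mem_autExtensionGroup.2 ⟨Subgroup.le_normalizer hy,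
    ⟨⟨(α ⟨y, hy⟩ : P), Subgroup.le_normalizer (α ⟨y, hy⟩).2⟩, ?_⟩⟩
  ext x
  have h : P.normalizerMonoidHom ⟨y, Subgroup.le_normalizer hy⟩ = MulAut.conj ⟨y, hy⟩ := by
    ext z
    simp
  rw [h]
  simp [MulAut.conj_apply]

/-! ### The normalizer fusion system -/

/-- The morphisms `Q → R` of the normalizer fusion system `N_F(P)`, for `Q, R ≤ N_S(P)`: the
`φ ∈ Hom_F(Q, R)` that extend to some `φ' ∈ Hom_F(Q P, R P)` with `φ'(P) = P`. (As `Q` and `R`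
normalize `P`, the products `Q P` and `R P` are the joins `Q ⊔ P` and `R ⊔ P`.) -/
def normalizerHom (P Q R : Subgroup S) : Set (Q →* R) :=
  {φ | φ ∈ F.Hom Q R ∧ ∃ φ' ∈ F.Hom (Q ⊔ P) (R ⊔ P),
    homRestrict φ' le_sup_left = (Subgroup.inclusion le_sup_left).comp φ ∧
    homImage (homRestrict φ' (le_sup_right : P ≤ Q ⊔ P)) = P}

/-- The subgroup `Q ≤ N_S(P)` is `N_F(P)`-centric: each `N_F(P)`-conjugate `R` of `Q` contains its
centralizer in `N_S(P)`. -/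
def IsNormalizerCentric (P Q : Subgroup S) : Prop :=
  ∀ R : Subgroup S, R ≤ Subgroup.normalizer (P : Set S) →
    (∃ e : Q ≃* R, e.toMonoidHom ∈ F.normalizerHom P Q R ∧
      e.symm.toMonoidHom ∈ F.normalizerHom P R Q) →
    Subgroup.centralizer (R : Set S) ⊓ Subgroup.normalizer (P : Set S) ≤ R

variable {F} in
theorem IsCentric.isNormalizerCentric {P Q : Subgroup S} (h : F.IsCentric Q) :
    F.IsNormalizerCentric P Q := by
  rintro R - ⟨e, he, he'⟩
  exact inf_le_left.trans (h R ⟨e, he.1, he'.1⟩)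

theorem homImage_comp_of_eq {P A B C : Subgroup S} (hA : P ≤ A) (hB : P ≤ B) (φ : A →* B)
    (ψ : B →* C) (hφ : homImage (homRestrict φ hA) = P) (hψ : homImage (homRestrict ψ hB) = P) :
    homImage (homRestrict (ψ.comp φ) hA) = P := by
  have hφ' : ∀ x : P, (φ (Subgroup.inclusion hA x) : S) ∈ P := fun x => by
    have h : (φ (Subgroup.inclusion hA x) : S) ∈ homImage (homRestrict φ hA) :=
      Subgroup.mem_map_of_mem B.subtype ⟨x, rfl⟩
    rwa [hφ] at h
  apply le_antisymm
  · rintro _ ⟨_, ⟨x, rfl⟩, rfl⟩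
    have h : (ψ (Subgroup.inclusion hB ⟨_, hφ' x⟩) : S) ∈ homImage (homRestrict ψ hB) :=
      Subgroup.mem_map_of_mem C.subtype ⟨_, rfl⟩
    rw [hψ] at h
    exact h
  · intro y hy
    rw [← hψ] at hy
    obtain ⟨_, ⟨x, rfl⟩, rfl⟩ := hy
    obtain ⟨x, hx⟩ := x
    have hx' := hx
    rw [← hφ] at hx'
    obtain ⟨_, ⟨w, rfl⟩, rfl⟩ := hx'
    exact ⟨_, ⟨w, rfl⟩, rfl⟩

theorem homImage_id {P A : Subgroup S} (hA : P ≤ A) :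
    homImage (homRestrict (MonoidHom.id A) hA) = P := by
  apply le_antisymm
  · rintro _ ⟨_, ⟨x, rfl⟩, rfl⟩
    exact x.2
  · intro y hy
    exact ⟨_, ⟨⟨y, hy⟩, rfl⟩, rfl⟩

theorem normalizerHom_id (P Q : Subgroup S) : MonoidHom.id Q ∈ F.normalizerHom P Q Q := by
  exact ⟨F.id_mem Q, MonoidHom.id _, F.id_mem _, rfl, homImage_id _⟩

theorem normalizerHom_comp {P Q R T : Subgroup S} {φ : Q →* R} {ψ : R →* T}
    (hφ : φ ∈ F.normalizerHom P Q R) (hψ : ψ ∈ F.normalizerHom P R T) :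
    ψ.comp φ ∈ F.normalizerHom P Q T := by
  obtain ⟨h1, φ', h2, h3, h4⟩ := hφ
  obtain ⟨k1, ψ', k2, k3, k4⟩ := hψ
  refine ⟨F.comp_mem h1 k1, ψ'.comp φ', F.comp_mem h2 k2, ?_,
    homImage_comp_of_eq _ le_sup_right _ _ h4 k4⟩
  ext x
  have e1 := DFunLike.congr_fun h3 x
  have e2 := DFunLike.congr_fun k3 (φ x)
  simp only [homRestrict, MonoidHom.comp_apply] at e1 e2 ⊢
  rw [e1, e2]

/-! ### Linking systems -/

/-- The `F`-centric subgroups of `S`. -/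
structure CentricSubgroup where
  /-- The underlying subgroup. -/
  toSubgroup : Subgroup S
  isCentric : F.IsCentric toSubgroup

/-- A centric linking system associated to `F`: a category whose objects are the `F`-centric
subgroups of `S`, with a functor `π` (`proj`) to `F` that is the identity on objects, and
distinguished monomorphisms `δ_P : P → Aut(P)` (`dist`). -/
structure CentricLinkingSystem where
  category : Category.{v} F.CentricSubgroup
  /-- The functor `π` on morphisms. -/
  proj : ∀ {P Q : F.CentricSubgroup}, (P ⟶ Q) → (P.toSubgroup →* Q.toSubgroup)
  proj_id : ∀ P : F.CentricSubgroup, proj (𝟙 P) = MonoidHom.id P.toSubgroup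
  proj_comp : ∀ {P Q R : F.CentricSubgroup} (f : P ⟶ Q) (g : Q ⟶ R),
    proj (f ≫ g) = (proj g).comp (proj f)
  /-- The monomorphisms `δ_P`. -/
  dist : ∀ P : F.CentricSubgroup, P.toSubgroup →* Aut P
  dist_injective : ∀ P : F.CentricSubgroup, Function.Injective (dist P)
  /-- `π` maps `Hom(P, Q)` onto `Hom_F(P, Q)`. -/
  range_proj : ∀ P Q : F.CentricSubgroup,
    Set.range (proj (P := P) (Q := Q)) = F.Hom P.toSubgroup Q.toSubgroup
  /-- `Z(P)` acts freely on `Hom(P, Q)`. -/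
  free : ∀ {P Q : F.CentricSubgroup} (f : P ⟶ Q), ∀ z ∈ Subgroup.center P.toSubgroup,
    (dist P z).hom ≫ f = f → z = 1
  /-- The fibres of `π` are the `Z(P)`-orbits. -/
  proj_eq_iff : ∀ {P Q : F.CentricSubgroup} (f g : P ⟶ Q),
    proj f = proj g ↔ ∃ z ∈ Subgroup.center P.toSubgroup, g = (dist P z).hom ≫ f
  /-- `π(δ_P(g)) = c_g`. -/
  proj_dist : ∀ (P : F.CentricSubgroup) (g : P.toSubgroup),
    proj (dist P g).hom = (MulAut.conj g).toMonoidHom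
  /-- `δ_Q(π(f)(g)) ∘ f = f ∘ δ_P(g)`. -/
  comm : ∀ {P Q : F.CentricSubgroup} (f : P ⟶ Q) (g : P.toSubgroup),
    f ≫ (dist Q (proj f g)).hom = (dist P g).hom ≫ f

variable {F}

namespace CentricLinkingSystem

variable (L : F.CentricLinkingSystem)

/-- The type of objects of the linking system `L`. -/
def Obj (_ : F.CentricLinkingSystem) : Type u := F.CentricSubgroup

instance : Category L.Obj := L.category

variable {L} in
/-- The subgroup of `S` underlying an object of `L`. -/
def Obj.toSubgroup (X : L.Obj) : Subgroup S := CentricSubgroup.toSubgroup X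

/-- The functor `π : L → F` on morphisms. -/
def map {X Y : L.Obj} (f : X ⟶ Y) : X.toSubgroup →* Y.toSubgroup := L.proj f

theorem map_id (X : L.Obj) : L.map (𝟙 X) = MonoidHom.id X.toSubgroup := L.proj_id X

theorem map_comp {X Y Z : L.Obj} (f : X ⟶ Y) (g : Y ⟶ Z) :
    L.map (f ≫ g) = (L.map g).comp (L.map f) := L.proj_comp f g

/-- The objects of the normalizer `N_L(P)` of an `F`-centric subgroup `P` in `L`: the
`N_F(P)`-centric subgroups of `N_S(P)`. -/
structure NormalizerObj (L : F.CentricLinkingSystem) {P : Subgroup S} (hP : F.IsCentric P) where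
  /-- The underlying subgroup. -/
  toSubgroup : Subgroup S
  le_normalizer : toSubgroup ≤ Subgroup.normalizer (P : Set S)
  isCentric : F.IsNormalizerCentric P toSubgroup

variable {P : Subgroup S} {hP : F.IsCentric P}

/-- The subgroup `Q P`, as an object of `L`. -/
def NormalizerObj.prod (Q : L.NormalizerObj hP) : L.Obj :=
  (⟨Q.toSubgroup ⊔ P, hP.of_le le_sup_right⟩ : F.CentricSubgroup)

/-- The morphisms `Q → R` of `N_L(P)`: the `φ ∈ Hom_L(Q P, R P)` such that `π(φ)` restricts to an
element of `Hom_{N_F(P)}(Q, R)` and `π(φ)(P) = P`. -/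
@[ext] structure NormalizerObj.Hom (Q R : L.NormalizerObj hP) where
  /-- The underlying morphism of `L`. -/
  hom : Q.prod ⟶ R.prod
  restrict_mem : ∃ ψ ∈ F.normalizerHom P Q.toSubgroup R.toSubgroup,
    homRestrict (L.map hom) (le_sup_left : Q.toSubgroup ≤ Q.toSubgroup ⊔ P) =
      (Subgroup.inclusion le_sup_left).comp ψ
  image_eq : homImage (homRestrict (L.map hom) (le_sup_right : P ≤ Q.toSubgroup ⊔ P)) = P

/-- The category `N_L(P)`; the composition is that of `L`. -/
instance : Category (L.NormalizerObj hP) where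
  Hom Q R := NormalizerObj.Hom L Q R
  id Q :=
    { hom := 𝟙 Q.prod
      restrict_mem := ⟨MonoidHom.id _, F.normalizerHom_id P _, by rw [L.map_id]; rfl⟩
      image_eq := by rw [L.map_id]; exact homImage_id _ }
  comp {Q R T} f g :=
    { hom := f.hom ≫ g.hom
      restrict_mem := by
        obtain ⟨φ, hφ, h1⟩ := f.restrict_mem
        obtain ⟨ψ, hψ, h2⟩ := g.restrict_mem
        refine ⟨ψ.comp φ, F.normalizerHom_comp hφ hψ, ?_⟩
        rw [L.map_comp]
        refine MonoidHom.ext fun x => ?_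
        exact (congrArg (L.map g.hom) (DFunLike.congr_fun h1 x)).trans
          (DFunLike.congr_fun h2 (φ x))
      image_eq := by
        rw [L.map_comp]
        exact homImage_comp_of_eq _ _ _ _ f.image_eq g.image_eq }
  id_comp f := NormalizerObj.Hom.ext (Category.id_comp f.hom)
  comp_id f := NormalizerObj.Hom.ext (Category.comp_id f.hom)
  assoc f g h := NormalizerObj.Hom.ext (Category.assoc f.hom g.hom h.hom)

/-- The functor `N_L(P) ⥤ L` sending a morphism to its underlying morphism of `L`. -/
def toLinking (hP : F.IsCentric P) : L.NormalizerObj hP ⥤ L.Obj where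
  obj Q := Q.prod
  map f := f.hom
  map_id _ := rfl
  map_comp _ _ := rfl

/-- `P` as an object of `N_L(P)`. -/
def normalizerBase (hP : F.IsCentric P) : L.NormalizerObj hP :=
  ⟨P, Subgroup.le_normalizer, hP.isNormalizerCentric⟩

/-- `P̃` as an object of `N_L(P)`. -/
def normalizerTilde (hP : F.IsCentric P) : L.NormalizerObj hP :=
  ⟨F.tilde P, F.tilde_le_normalizer P, (hP.of_le (F.le_tilde P)).isNormalizerCentric⟩

/-- The full subcategory of the undercategory `P ↓ N_L(P)` on the morphisms `P → Q` of `N_L(P)`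
that are not isomorphisms in `L`. -/
abbrev NonIsoUnder (hP : F.IsCentric P) : Type (max u v) :=
  ObjectProperty.FullSubcategory fun X : Under (L.normalizerBase hP) =>
    ¬ IsIso ((L.toLinking hP).map X.hom)

end CentricLinkingSystem

end FusionSystem

/-- The geometric realization of the nerve of a category. -/
noncomputable abbrev nerveRealization (C : Type u) [Category.{v} C] : TopCat.{max u v} :=
  SSet.toTop.obj (nerve C)

/-!
An extension of `α ∈ Aut_F(P)` to a group containing `y ∈ N_S(P)` carries `c_y` to `α c_y α⁻¹`, so
that `y ∈ N_α`; conversely saturation extends `α` to `N_α`, which contains `P̃`. As `P` is not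
radical, `Out_F(P)` has a nontrivial normal `p`-subgroup. It lies in every Sylow `p`-subgroup, in
particular in `Out_S(P)`, and an element of `N_S(P)` inducing a nontrivial element of it lies in
`P̃` but not in `P`.

A morphism `P → Q` of `N_L(P)` has normal image in `QP`, hence is an epimorphism. So the
undercategory of non-isomorphisms `P → Q` is a preorder, where `(P → Q) ≤ (P → Q P̃) ≥ (P → P̃)`.
The homotopies that contract its realization come from these two inequalities, and for
`P̃ ↓ N_L(P)` from the initial object.

The homotopy attached to a natural transformation `F ⟶ G` uses the triangulation of the prism
`[1] × [n]`: a point of `|[1] × [n]|` is a probability measure on `[1] × [n]` supported on a chain,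
and there is exactly one with given marginals on `[1]` and `[n]`, their monotone coupling. This
identifies `|[1] × [n]|` with `Δ¹ × Δⁿ`.
-/

/-! ### Points of geometric realizations -/

section Realization

open Simplicial Opposite

/-- The characteristic map `Δⁿ → |Y|` of an `n`-simplex `y` of `Y`. -/
noncomputable def charMap {Y : SSet.{u}} {n : ℕ} (y : Y _⦋n⦌) :
    C(stdSimplex ℝ (Fin (n + 1)), SSet.toTop.obj Y) :=
  TopCat.toSSetObjEquiv _ _ ((sSetTopAdj.unit.app Y).app (op ⦋n⦌) y)

theorem charMap_map {Y : SSet.{u}} {m n : ℕ} (f : ⦋m⦌ ⟶ ⦋n⦌) (y : Y _⦋n⦌)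
    (t : stdSimplex ℝ (Fin (m + 1))) :
    charMap (Y.map f.op y) t = charMap y (stdSimplex.map f t) := by
  have h := NatTrans.naturality_apply (sSetTopAdj.unit.app Y) f.op y
  exact (congrArg (fun k => TopCat.toSSetObjEquiv _ (op ⦋m⦌) k t) h).trans
    (TopCat.toSSetObjEquiv_naturality_apply f ((sSetTopAdj.unit.app Y).app (op ⦋n⦌) y) t)

theorem toTop_map_charMap {X Y : SSet.{u}} (g : X ⟶ Y) {n : ℕ} (x : X _⦋n⦌)
    (t : stdSimplex ℝ (Fin (n + 1))) :
    SSet.toTop.map g (charMap x t) = charMap (g.app _ x) t :=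
  (congrArg (fun k => TopCat.toSSetObjEquiv _ _ (k.app (op ⦋n⦌) x) t)
    (sSetTopAdj.unit.naturality g)).symm

theorem toTop_hom_ext {X : SSet.{u}} {Z : TopCat.{u}} {f g : SSet.toTop.obj X ⟶ Z}
    (h : ∀ (n : ℕ) (x : X _⦋n⦌) (t : stdSimplex ℝ (Fin (n + 1))),
      f (charMap x t) = g (charMap x t)) : f = g := by
  refine (sSetTopAdj.homEquiv X Z).injective ?_
  ext n x
  refine (TopCat.toSSetObjEquiv Z n).injective (ContinuousMap.ext fun t => ?_)
  simp only [Adjunction.homEquiv_unit]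
  exact h n.unop.len x t

theorem exists_toTop_hom {X : SSet.{u}} {Z : TopCat.{u}}
    (c : ∀ n : ℕ, X _⦋n⦌ → C(stdSimplex ℝ (Fin (n + 1)), Z))
    (hc : ∀ (m n : ℕ) (f : ⦋m⦌ ⟶ ⦋n⦌) (x : X _⦋n⦌) (t : stdSimplex ℝ (Fin (m + 1))),
      c m (X.map f.op x) t = c n x (stdSimplex.map f t)) :
    ∃ g : SSet.toTop.obj X ⟶ Z, ∀ (n : ℕ) (x : X _⦋n⦌) (t : stdSimplex ℝ (Fin (n + 1))),
      g (charMap x t) = c n x t := by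
  let k : X ⟶ TopCat.toSSet.obj Z :=
    { app n := ↾fun x => (TopCat.toSSetObjEquiv Z n).symm (c n.unop.len x)
      naturality n m f := by
        ext x
        exact (TopCat.toSSetObjEquiv Z m).injective (ContinuousMap.ext fun t => hc _ _ f.unop x t) }
  refine ⟨(sSetTopAdj.homEquiv X Z).symm k, fun n x t => ?_⟩
  have h := (sSetTopAdj.homEquiv X Z).apply_symm_apply k
  rw [Adjunction.homEquiv_unit] at h
  exact congrArg (fun k => TopCat.toSSetObjEquiv _ _ (k.app (op ⦋n⦌) x) t) h

end Realization

/-! ### Barycentric coordinates -/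

section Barycentric

open Function

variable {X Y : Type*} [Fintype X] [Fintype Y]

theorem simplexMap_apply [DecidableEq Y] (f : X → Y) (t : stdSimplex ℝ X) (y : Y) :
    stdSimplex.map f t y = ∑ x with f x = y, t x := by
  rw [stdSimplex.map_coe, FunOnFinite.linearMap_apply_apply]

theorem simplexMap_apply_of_injective {f : X → Y} (hf : Function.Injective f) (t : stdSimplex ℝ X)
    (x : X) : stdSimplex.map f t (f x) = t x := by
  classical
  simp only [simplexMap_apply, hf.eq_iff, Finset.sum_filter, Finset.sum_ite_eq', Finset.mem_univ,
    if_true]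

theorem simplexMap_injective {f : X → Y} (hf : Function.Injective f) :
    Function.Injective (stdSimplex.map (S := ℝ) f) := fun s t h => by
  ext x
  rw [← simplexMap_apply_of_injective hf s, h, simplexMap_apply_of_injective hf]

theorem support_simplexMap (f : X → Y) (t : stdSimplex ℝ X) :
    support (stdSimplex.map f t) = f '' support t := by
  classical
  ext y
  rw [mem_support, simplexMap_apply, Ne,
    Finset.sum_eq_zero_iff_of_nonneg fun x _ => stdSimplex.zero_le t x]
  simp [and_comm]

theorem exists_simplexMap_eq {f : X → Y} (hf : Function.Injective f) {w : stdSimplex ℝ Y}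
    (hw : support w ⊆ Set.range f) : ∃ t, stdSimplex.map f t = w := by
  classical
  have hsum : ∑ x, w (f x) = 1 := by
    rw [← stdSimplex.sum_eq_one w, ← Finset.sum_image (s := Finset.univ) (f := w)
      fun a _ b _ h => hf h]
    refine Finset.sum_subset (Finset.subset_univ _) fun y _ hy => not_not.1 fun h => hy ?_
    simpa using hw h
  let t : stdSimplex ℝ X := ⟨fun x => w (f x), fun x => stdSimplex.zero_le w (f x), hsum⟩
  refine ⟨t, stdSimplex.ext (funext fun y => ?_)⟩
  by_cases hy : y ∈ Set.range f
  · obtain ⟨x, rfl⟩ := hy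
    exact simplexMap_apply_of_injective hf t x
  · have ht : y ∉ support (stdSimplex.map f t) := by
      rw [support_simplexMap]
      exact fun h => hy (Set.image_subset_range _ _ h)
    rw [notMem_support.1 ht, notMem_support.1 fun h => hy (hw h)]

theorem support_simplex_nonempty (t : stdSimplex ℝ X) : (support t).Nonempty := by
  rw [support_nonempty_iff]
  intro h
  simpa [h] using stdSimplex.sum_eq_one t

end Barycentric

/-! ### Order complexes -/

section OrderComplex

open Function Simplicial

variable {Q : Type*} [PartialOrder Q] {D : Type u} [Category.{v} D]

/-- The simplex of the nerve of `D` obtained by restricting a functor `Q ⥤ D` to the chain `σ`. -/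
def nerveChain (G : Q ⥤ D) {a : ℕ} (σ : Fin (a + 1) →o Q) :
    (nerve D) _⦋a⦌ :=
  (σ.monotone.functor ⋙ G : Fin (a + 1) ⥤ D)

theorem charMap_nerveChain_comp (G : Q ⥤ D) {a b : ℕ} (σ : Fin (a + 1) →o Q)
    (f : Fin (b + 1) →o Fin (a + 1)) (t : stdSimplex ℝ (Fin (b + 1))) :
    charMap (nerveChain G (σ.comp f)) t = charMap (nerveChain G σ) (stdSimplex.map f t) :=
  charMap_map (SimplexCategory.mkHom f) (nerveChain G σ) t

variable [Fintype Q]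

/-- The order complex of a finite poset `Q`, realized inside the simplex with vertex set `Q`: the
weights whose support is a chain. -/
def orderComplex (Q : Type*) [PartialOrder Q] [Fintype Q] : Set (stdSimplex ℝ Q) :=
  {w | IsChain (· ≤ ·) (support w)}

theorem simplexMap_mem_orderComplex {R : Type*} [PartialOrder R] [Fintype R] (f : Q →o R)
    {w : stdSimplex ℝ Q} (hw : w ∈ orderComplex Q) : stdSimplex.map f w ∈ orderComplex R := by
  simp only [orderComplex, Set.mem_ofPred_eq, support_simplexMap] at hw ⊢
  exact f.monotone.isChain_image hw

theorem mem_orderComplex {A : Type*} [LinearOrder A] [Fintype A] (t : stdSimplex ℝ A) :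
    t ∈ orderComplex A :=
  fun a _ b _ _ => le_total a b

theorem exists_simplexMap_orderEmbedding_eq {w : stdSimplex ℝ Q} (hw : w ∈ orderComplex Q) :
    ∃ (a : ℕ) (e : Fin (a + 1) ↪o Q) (t : stdSimplex ℝ (Fin (a + 1))),
      stdSimplex.map e t = w ∧ Set.range e = support w := by
  classical
  let := IsChain.linearOrder hw
  have : Nonempty (support w) := (support_simplex_nonempty w).to_subtype
  obtain ⟨a, ha⟩ := Nat.exists_eq_succ_of_ne_zero (Fintype.card_ne_zero (α := support w))
  let i : Fin (a + 1) ≃o support w := Fintype.orderIsoFinOfCardEq (support w) ha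
  let e : Fin (a + 1) ↪o Q := i.toOrderEmbedding.trans (OrderEmbedding.subtype _)
  have he : Set.range e = support w :=
    (i.surjective.range_comp Subtype.val).trans Subtype.range_val
  obtain ⟨t, ht⟩ := exists_simplexMap_eq e.injective he.ge
  exact ⟨a, e, t, ht, he⟩

theorem charMap_nerveChain_eq_of_map_eq (G : Q ⥤ D) {a c : ℕ} {σ : Fin (a + 1) →o Q}
    {e : Fin (c + 1) ↪o Q} {t : stdSimplex ℝ (Fin (a + 1))} {u : stdSimplex ℝ (Fin (c + 1))}
    (h : stdSimplex.map σ t = stdSimplex.map e u) :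
    charMap (nerveChain G σ) t = charMap (nerveChain G e.toOrderHom) u := by
  obtain ⟨b, i, t, rfl, hi⟩ := exists_simplexMap_orderEmbedding_eq (mem_orderComplex t)
  have hmem (j) : σ (i j) ∈ Set.range e := by
    have hj : σ (i j) ∈ support (stdSimplex.map σ (stdSimplex.map i t)) := by
      rw [support_simplexMap, ← hi]
      exact Set.mem_image_of_mem σ (Set.mem_range_self j)
    rw [h, support_simplexMap] at hj
    exact Set.image_subset_range _ _ hj
  choose q hq using hmem
  let q' : Fin (b + 1) →o Fin (c + 1) := ⟨q, fun j k hjk => by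
    rw [← e.le_iff_le, hq, hq]
    exact σ.monotone (i.monotone hjk)⟩
  have hcomp : σ.comp i.toOrderHom = e.toOrderHom.comp q' := by
    ext j : 2
    exact (hq j).symm
  have hu : stdSimplex.map q' t = u := simplexMap_injective e.injective <| by
    rw [← h, stdSimplex.map_comp_apply, stdSimplex.map_comp_apply]
    exact congrArg (fun f => stdSimplex.map f t) (funext hq)
  rw [← hu, ← charMap_nerveChain_comp, ← hcomp, charMap_nerveChain_comp]
  rfl

/-- The simplices of the order complex of `Q` (those of dimension at least `|Q|` would be empty). -/
abbrev ChainPoint (Q : Type*) [PartialOrder Q] [Fintype Q] : Type _ :=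
  Σ (a : Fin (Fintype.card Q)) (_ : Fin (a + 1) ↪o Q), stdSimplex ℝ (Fin (a + 1))

/-- The gluing map from the disjoint union of the closed simplices to the order complex. -/
noncomputable def glueChains (Q : Type*) [PartialOrder Q] [Fintype Q] :
    C(ChainPoint Q, orderComplex Q) where
  toFun z := ⟨stdSimplex.map z.2.1 z.2.2,
    simplexMap_mem_orderComplex z.2.1.toOrderHom (mem_orderComplex z.2.2)⟩
  continuous_toFun := by
    refine continuous_sigma fun a => continuous_sigma fun e => ?_
    exact (stdSimplex.continuous_map e).subtype_mk _

theorem isQuotientMap_glueChains : Topology.IsQuotientMap (glueChains Q) := by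
  have (a : ℕ) : Finite (Fin (a + 1) ↪o Q) := Finite.of_injective _ DFunLike.coe_injective
  refine Topology.IsQuotientMap.of_surjective_continuous (fun w => ?_) (map_continuous _)
  obtain ⟨a, e, t, ht, -⟩ := exists_simplexMap_orderEmbedding_eq w.2
  have ha : a < Fintype.card Q := by
    simpa using Fintype.card_le_of_injective e e.injective
  exact ⟨⟨⟨a, ha⟩, e, t⟩, Subtype.ext ht⟩

theorem exists_realization_orderComplex (G : Q ⥤ D) :
    ∃ r : C(orderComplex Q, nerveRealization D),
      ∀ {a : ℕ} (σ : Fin (a + 1) →o Q) (t : stdSimplex ℝ (Fin (a + 1))),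
        r ⟨stdSimplex.map σ t, simplexMap_mem_orderComplex σ (mem_orderComplex t)⟩ =
          charMap (nerveChain G σ) t := by
  let c : C(ChainPoint Q, nerveRealization D) :=
    ⟨fun z => charMap (nerveChain G z.2.1.toOrderHom) z.2.2,
      continuous_sigma fun a => continuous_sigma fun e =>
        map_continuous (charMap (nerveChain G e.toOrderHom))⟩
  have hc : FactorsThrough c (glueChains Q) := fun y z h =>
    charMap_nerveChain_eq_of_map_eq G (congrArg Subtype.val h)
  refine ⟨isQuotientMap_glueChains.lift c hc, fun σ t => ?_⟩
  set w : orderComplex Q := ⟨stdSimplex.map σ t, _⟩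
  obtain ⟨z, hz⟩ := isQuotientMap_glueChains.surjective w
  have hlift : isQuotientMap_glueChains.lift c hc w = c z := by
    rw [← hz]
    exact DFunLike.congr_fun (isQuotientMap_glueChains.lift_comp c hc) z
  rw [hlift]
  exact (charMap_nerveChain_eq_of_map_eq G (congrArg Subtype.val hz).symm).symm

end OrderComplex

/-! ### Prisms -/

section Prism

open Function Finset

theorem sum_sub_Iic_Iio {A M : Type*} [LinearOrder A] [Fintype A] [LocallyFiniteOrderBot A]
    [AddCommGroup M] (g : Finset A → M) : ∑ a, (g (Iic a) - g (Iio a)) = g univ - g ∅ := by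
  suffices h : ∀ L : Finset A, IsLowerSet (L : Set A) →
      ∑ a ∈ L, (g (Iic a) - g (Iio a)) = g L - g ∅ from
    h univ (by simpa using isLowerSet_univ)
  refine fun L => Finset.induction_on_max L (by simp) fun a L ha ih hL => ?_
  have hLa : L = Iio a := by
    ext b
    refine ⟨fun hb => mem_Iio.2 (ha b hb), fun hb => ?_⟩
    have hb' := hL (mem_Iio.1 hb).le (mem_insert_self a L)
    exact mem_of_mem_insert_of_ne hb' (mem_Iio.1 hb).ne
  rw [sum_insert fun h => lt_irrefl a (ha a h), ih (by simpa [hLa] using isLowerSet_Iio a), hLa,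
    Iio_insert, sub_add_sub_cancel]

/-- The poset `[1] × A`, as a type of its own so that as a category it carries only the structure of
a poset, and not also that of a product category. -/
def Prism (A : Type*) : Type _ := Fin 2 × A

namespace Prism

variable {A B : Type*}

instance [PartialOrder A] : PartialOrder (Prism A) := inferInstanceAs (PartialOrder (Fin 2 × A))

instance [Fintype A] : Fintype (Prism A) := inferInstanceAs (Fintype (Fin 2 × A))

/-- The inclusion of the face `{ε} × A`. -/
def face [PartialOrder A] (ε : Fin 2) : A →o Prism A :=
  ⟨fun a => (ε, a), fun _ _ h => ⟨le_rfl, h⟩⟩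

/-- The map of prisms `[1] × A → [1] × B` induced by a monotone map. -/
def map [PartialOrder A] [PartialOrder B] (f : A →o B) : Prism A →o Prism B :=
  ⟨fun q => (q.1, f q.2), fun _ _ h => ⟨h.1, f.monotone h.2⟩⟩

/-- The projection of the prism to `[1]`. -/
def fst [PartialOrder A] : Prism A →o Fin 2 :=
  ⟨fun q => q.1, fun _ _ h => h.1⟩

/-- The projection of the prism to `A`. -/
def snd [PartialOrder A] : Prism A →o A :=
  ⟨fun q => q.2, fun _ _ h => h.2⟩

@[simp]
theorem fst_face [PartialOrder A] (ε : Fin 2) (a : A) : fst (face ε a) = ε := rfl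

@[simp]
theorem snd_face [PartialOrder A] (ε : Fin 2) (a : A) : snd (face ε a) = a := rfl

section Marginals

variable [PartialOrder A] [Fintype A]

theorem sum_eq {M : Type*} [AddCommMonoid M] (g : Prism A → M) :
    ∑ q, g q = ∑ a, (g (face 0 a) + g (face 1 a)) := by
  refine (Fintype.sum_prod_type_right (fun q : Fin 2 × A => g q)).trans ?_
  simp only [Fin.sum_univ_two]
  rfl

theorem simplexMap_fst_apply (w : stdSimplex ℝ (Prism A)) (ε : Fin 2) :
    stdSimplex.map fst w ε = ∑ a, w (face ε a) := by
  rw [simplexMap_apply, sum_filter, sum_eq]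
  fin_cases ε <;> simp only [fst_face] <;> simp

theorem simplexMap_snd_apply (w : stdSimplex ℝ (Prism A)) (a : A) :
    stdSimplex.map snd w a = w (face 0 a) + w (face 1 a) := by
  classical
  rw [simplexMap_apply, sum_filter, sum_eq, Fintype.sum_eq_single a fun b hb => by simp [hb]]
  simp only [snd_face, if_true]

theorem sum_lowerSet {w : stdSimplex ℝ (Prism A)} (hw : w ∈ orderComplex (Prism A)) {L : Finset A}
    (hL : IsLowerSet (L : Set A)) :
    ∑ a ∈ L, w (face 0 a) =
      min (stdSimplex.map fst w 0) (∑ a ∈ L, stdSimplex.map snd w a) := by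
  have hfst : ∑ a ∈ L, w (face 0 a) ≤ stdSimplex.map fst w 0 := by
    rw [simplexMap_fst_apply]
    exact sum_le_univ_sum_of_nonneg fun a => stdSimplex.zero_le w _
  have hsnd : ∑ a ∈ L, w (face 0 a) ≤ ∑ a ∈ L, stdSimplex.map snd w a :=
    sum_le_sum fun a _ => by
      rw [simplexMap_snd_apply]
      exact le_add_of_nonneg_right (stdSimplex.zero_le w _)
  refine (le_min hfst hsnd).antisymm ?_
  by_cases h : ∃ a ∈ L, w (face 1 a) ≠ 0
  · obtain ⟨a, haL, ha⟩ := h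
    refine (min_le_left _ _).trans_eq ?_
    rw [simplexMap_fst_apply]
    refine (sum_subset (subset_univ L) fun b _ hb => not_not.1 fun hb0 => ?_).symm
    rcases hw.total hb0 ha with h | h
    · exact hb (hL (snd.monotone h) haL)
    · exact absurd (fst.monotone h) (by simp)
  · push Not at h
    refine (min_le_right _ _).trans_eq (sum_congr rfl fun a ha => ?_)
    rw [simplexMap_snd_apply, h a ha, add_zero]

end Marginals

section Coupling

variable [LinearOrder A] [Fintype A] [LocallyFiniteOrderBot A]

/-- The mass at `(0, a)` of the monotone coupling: with `[0, 1]` cut into intervals of lengths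
`t`, the length of the part of the `a`-th interval below `r 0`. -/
noncomputable def couplingMass (r : stdSimplex ℝ (Fin 2)) (t : stdSimplex ℝ A) (a : A) : ℝ :=
  min (r 0) (∑ b ∈ Iic a, t b) - min (r 0) (∑ b ∈ Iio a, t b)

variable (r : stdSimplex ℝ (Fin 2)) (t : stdSimplex ℝ A)

theorem sum_Iic_eq (a : A) : ∑ b ∈ Iic a, t b = t a + ∑ b ∈ Iio a, t b := by
  rw [← Iio_insert, sum_insert (by simp)]

theorem couplingMass_nonneg (a : A) : 0 ≤ couplingMass r t a := by
  have := stdSimplex.zero_le t a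
  rw [couplingMass, sum_Iic_eq, sub_nonneg]
  exact min_le_min_left _ (by linarith)

theorem couplingMass_le (a : A) : couplingMass r t a ≤ t a := by
  have := stdSimplex.zero_le t a
  rw [couplingMass, sum_Iic_eq, sub_le_iff_le_add, ← min_add_add_left]
  exact min_le_min_right _ (by linarith)

theorem sum_couplingMass : ∑ a, couplingMass r t a = r 0 := by
  refine (sum_sub_Iic_Iio fun L => min (r 0) (∑ b ∈ L, t b)).trans ?_
  rw [stdSimplex.sum_eq_one, min_eq_left (stdSimplex.le_one r 0), sum_empty,
    min_eq_right (stdSimplex.zero_le r 0), sub_zero]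

/-- The monotone coupling of `r` and `t`: the weights on the prism with marginals `r` and `t` that
are supported on a chain. -/
noncomputable def coupling : stdSimplex ℝ (Prism A) :=
  ⟨fun q => if fst q = 0 then couplingMass r t (snd q) else t (snd q) - couplingMass r t (snd q),
    fun q => by
      beta_reduce
      split_ifs
      exacts [couplingMass_nonneg r t _, sub_nonneg.2 (couplingMass_le r t _)], by
    rw [sum_eq, ← stdSimplex.sum_eq_one t]
    simp⟩

theorem coupling_zero_apply (a : A) : coupling r t (face 0 a) = couplingMass r t a := rfl

theorem coupling_one_apply (a : A) : coupling r t (face 1 a) = t a - couplingMass r t a := rfl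

theorem simplexMap_snd_coupling : stdSimplex.map snd (coupling r t) = t := by
  ext a
  rw [simplexMap_snd_apply, coupling_zero_apply, coupling_one_apply, add_sub_cancel]

theorem simplexMap_fst_coupling : stdSimplex.map fst (coupling r t) = r := by
  have h : stdSimplex.map fst (coupling r t) 0 = r 0 := by
    simpa only [simplexMap_fst_apply, coupling_zero_apply] using sum_couplingMass r t
  have h₁ := stdSimplex.add_eq_one (stdSimplex.map fst (coupling r t))
  have h₂ := stdSimplex.add_eq_one r
  ext ε
  fin_cases ε
  · exact h
  · change stdSimplex.map fst (coupling r t) 1 = r 1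
    linarith

theorem coupling_mem_orderComplex : coupling r t ∈ orderComplex (Prism A) := by
  have le_of_ne {a b : A} (ha : coupling r t (face 0 a) ≠ 0)
      (hb : coupling r t (face 1 b) ≠ 0) : a ≤ b := by
    by_contra! hba
    have hb' : r 0 < ∑ c ∈ Iic b, t c := by
      by_contra! h
      apply hb
      have := stdSimplex.zero_le t b
      rw [sum_Iic_eq] at h
      rw [coupling_one_apply, couplingMass, sum_Iic_eq, min_eq_right h, min_eq_right (by linarith)]
      ring
    have ha' : r 0 < ∑ c ∈ Iio a, t c :=
      hb'.trans_le <| sum_le_sum_of_subset_of_nonneg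
        (fun c hc => mem_Iio.2 ((mem_Iic.1 hc).trans_lt hba)) fun c _ _ => stdSimplex.zero_le t c
    have := stdSimplex.zero_le t a
    apply ha
    rw [coupling_zero_apply, couplingMass, sum_Iic_eq, min_eq_left ha'.le,
      min_eq_left (by linarith), sub_self]
  rintro ⟨δ, a⟩ ha ⟨ε, b⟩ hb -
  rcases le_total δ ε with h | h <;> rcases h.eq_or_lt with rfl | h
  · exact (le_total a b).imp (⟨le_rfl, ·⟩) (⟨le_rfl, ·⟩)
  · obtain ⟨rfl, rfl⟩ : δ = 0 ∧ ε = 1 := by omega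
    exact Or.inl ⟨h.le, le_of_ne ha hb⟩
  · exact (le_total a b).imp (⟨le_rfl, ·⟩) (⟨le_rfl, ·⟩)
  · obtain ⟨rfl, rfl⟩ : ε = 0 ∧ δ = 1 := by omega
    exact Or.inr ⟨h.le, le_of_ne hb ha⟩

theorem eq_coupling {w : stdSimplex ℝ (Prism A)} (hw : w ∈ orderComplex (Prism A)) :
    w = coupling (stdSimplex.map fst w) (stdSimplex.map snd w) := by
  have h₀ (a : A) : w (face 0 a) =
      couplingMass (stdSimplex.map fst w) (stdSimplex.map snd w) a := by
    rw [couplingMass, ← sum_lowerSet hw (by simpa using isLowerSet_Iic a),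
      ← sum_lowerSet hw (by simpa using isLowerSet_Iio a), ← Iio_insert, sum_insert (by simp),
      add_sub_cancel_right]
  ext ⟨ε, a⟩
  fin_cases ε
  · exact h₀ a
  · refine Eq.trans ?_ (coupling_one_apply _ _ a).symm
    rw [← h₀, simplexMap_snd_apply, add_sub_cancel_left]
    rfl

theorem simplexMap_map_coupling {B : Type*} [Fintype B] [LinearOrder B] [LocallyFiniteOrderBot B]
    (f : A →o B) :
    stdSimplex.map (map f) (coupling r t) = coupling r (stdSimplex.map f t) := by
  rw [eq_coupling (simplexMap_mem_orderComplex (map f) (coupling_mem_orderComplex r t)),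
    stdSimplex.map_comp_apply, stdSimplex.map_comp_apply]
  congr 1
  · exact simplexMap_fst_coupling r t
  · rw [show snd ∘ map f = f ∘ snd from rfl, ← stdSimplex.map_comp_apply,
      simplexMap_snd_coupling]

theorem simplexMap_face (ε : Fin 2) :
    stdSimplex.map (face ε) t = coupling (stdSimplex.vertex ε) t := by
  rw [eq_coupling (simplexMap_mem_orderComplex (face ε) (mem_orderComplex t)),
    stdSimplex.map_comp_apply, stdSimplex.map_comp_apply]
  congr 1
  · ext δ
    classical
    rw [simplexMap_apply]
    obtain rfl | h := eq_or_ne δ ε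
    · simp
    · simp [h, h.symm]
  · exact stdSimplex.map_id_apply t

theorem continuous_coupling :
    Continuous fun z : stdSimplex ℝ (Fin 2) × stdSimplex ℝ A => coupling z.1 z.2 := by
  have hr (ε : Fin 2) : Continuous fun z : stdSimplex ℝ (Fin 2) × stdSimplex ℝ A => z.1 ε :=
    (continuous_apply ε).comp (continuous_subtype_val.comp continuous_fst)
  have ht (a : A) : Continuous fun z : stdSimplex ℝ (Fin 2) × stdSimplex ℝ A => z.2 a :=
    (continuous_apply a).comp (continuous_subtype_val.comp continuous_snd)
  have hm (a : A) : Continuous fun z : stdSimplex ℝ (Fin 2) × stdSimplex ℝ A =>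
      couplingMass z.1 z.2 a := by
    unfold couplingMass
    fun_prop
  refine Continuous.subtype_mk (continuous_pi fun q => ?_) _
  by_cases hq : fst q = 0
  · simp only [hq, if_true, hm]
  · simp only [hq, if_false]
    exact (ht (snd q)).sub (hm (snd q))

end Coupling

end Prism

end Prism

/-! ### Homotopies from natural transformations -/

section NaturalTransformation

open Simplicial

variable {C D : Type u} [Category.{v} C] [Category.{v} D]

/-- The functor `[1] × [n] ⥤ D` with `(ε, i) ↦ K ε (x i)`. -/
def prismFunctor (K : Fin 2 ⥤ C ⥤ D) {n : ℕ} (x : ComposableArrows C n) :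
    Prism (Fin (n + 1)) ⥤ D :=
  Functor.prod' Prism.fst.monotone.functor (Prism.snd.monotone.functor ⋙ x) ⋙
    Functor.uncurry.obj K

theorem nerveChain_prismFunctor_face (K : Fin 2 ⥤ C ⥤ D) {n : ℕ} (x : (nerve C) _⦋n⦌)
    (ε : Fin 2) :
    nerveChain (prismFunctor K x) (Prism.face ε) = (nerveMap (K.obj ε)).app _ x := by
  refine CategoryTheory.Functor.ext (fun _ => rfl) fun i j h => ?_
  have hid : (K.map (𝟙 ε)).app (x.obj i) = 𝟙 _ :=
    congrArg (fun k : K.obj ε ⟶ K.obj ε => k.app (x.obj i)) (K.map_id ε)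
  have hmap : (nerveChain (prismFunctor K x) (Prism.face ε)).map h =
      (K.map (𝟙 ε)).app (x.obj i) ≫ (K.obj ε).map (x.map h) := rfl
  rw [hmap, hid, Category.id_comp]
  exact ((Category.id_comp _).trans (Category.comp_id _)).symm

theorem exists_prismMap (K : Fin 2 ⥤ C ⥤ D) {n : ℕ} (x : (nerve C) _⦋n⦌) :
    ∃ h : C(stdSimplex ℝ (Fin (n + 1)) × unitInterval, nerveRealization D),
      ∀ {a : ℕ} (σ : Fin (a + 1) →o Prism (Fin (n + 1))) (w : stdSimplex ℝ (Fin (a + 1)))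
        (t : stdSimplex ℝ (Fin (n + 1))) (s : unitInterval),
        stdSimplex.map σ w = Prism.coupling (stdSimplexHomeomorphUnitInterval.symm s) t →
        h (t, s) = charMap (nerveChain (prismFunctor K x) σ) w := by
  obtain ⟨r, hr⟩ := exists_realization_orderComplex (prismFunctor K x)
  refine ⟨r.comp ⟨fun z => ⟨Prism.coupling (stdSimplexHomeomorphUnitInterval.symm z.2) z.1,
    Prism.coupling_mem_orderComplex _ _⟩, (Prism.continuous_coupling.comp
      ((map_continuous stdSimplexHomeomorphUnitInterval.symm).comp continuous_snd |>.prodMk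
        continuous_fst)).subtype_mk _⟩, fun σ w t s h => ?_⟩
  rw [← hr]
  exact congrArg r (Subtype.ext h.symm)

/-- The homotopy `Δⁿ × [0, 1] → |D|` that carries `[1] × [n]`, realized by the order complex of the
prism, along `prismFunctor K x`. -/
noncomputable def prismMap (K : Fin 2 ⥤ C ⥤ D) {n : ℕ} (x : (nerve C) _⦋n⦌) :
    C(stdSimplex ℝ (Fin (n + 1)) × unitInterval, nerveRealization D) :=
  (exists_prismMap K x).choose

theorem prismMap_apply (K : Fin 2 ⥤ C ⥤ D) {n : ℕ} (x : (nerve C) _⦋n⦌) {a : ℕ}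
    (σ : Fin (a + 1) →o Prism (Fin (n + 1))) (w : stdSimplex ℝ (Fin (a + 1)))
    {t : stdSimplex ℝ (Fin (n + 1))} {s : unitInterval}
    (h : stdSimplex.map σ w = Prism.coupling (stdSimplexHomeomorphUnitInterval.symm s) t) :
    prismMap K x (t, s) = charMap (nerveChain (prismFunctor K x) σ) w :=
  (exists_prismMap K x).choose_spec σ w t s h

theorem prismMap_map (K : Fin 2 ⥤ C ⥤ D) {m n : ℕ} (f : ⦋m⦌ ⟶ ⦋n⦌) (x : (nerve C) _⦋n⦌)
    (t : stdSimplex ℝ (Fin (m + 1))) (s : unitInterval) :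
    prismMap K ((nerve C).map f.op x) (t, s) = prismMap K x (stdSimplex.map f t, s) := by
  let f' : Fin (m + 1) →o Fin (n + 1) := f.toOrderHom
  obtain ⟨a, e, w, hw, -⟩ := exists_simplexMap_orderEmbedding_eq
    (Prism.coupling_mem_orderComplex (stdSimplexHomeomorphUnitInterval.symm s) t)
  have hfw : stdSimplex.map ((Prism.map f').comp e.toOrderHom) w =
      Prism.coupling (stdSimplexHomeomorphUnitInterval.symm s) (stdSimplex.map f' t) := by
    rw [← Prism.simplexMap_map_coupling, ← hw, stdSimplex.map_comp_apply]
    rfl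
  exact (prismMap_apply K _ e.toOrderHom w hw).trans (prismMap_apply K x _ w hfw).symm

theorem prismMap_vertex (K : Fin 2 ⥤ C ⥤ D) {n : ℕ} (x : (nerve C) _⦋n⦌)
    (t : stdSimplex ℝ (Fin (n + 1))) (ε : Fin 2) :
    prismMap K x (t, stdSimplexHomeomorphUnitInterval (stdSimplex.vertex ε)) =
      SSet.toTop.map (nerveMap (K.obj ε)) (charMap x t) := by
  rw [toTop_map_charMap, ← nerveChain_prismFunctor_face]
  refine prismMap_apply K x (Prism.face ε) t ?_
  rw [Homeomorph.symm_apply_apply, Prism.simplexMap_face]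

theorem homotopic_of_natTrans {F G : C ⥤ D} (η : F ⟶ G) :
    (SSet.toTop.map (nerveMap F)).hom.Homotopic (SSet.toTop.map (nerveMap G)).hom := by
  let K := ComposableArrows.mk₁ η
  -- Since `|C|` is known through the maps out of it, the homotopy is built as a map from `|C|` to
  -- the space of paths in `|D|`.
  obtain ⟨H, hH⟩ := exists_toTop_hom (X := nerve C)
    (Z := TopCat.of C(unitInterval, nerveRealization D)) (fun _ x => (prismMap K x).curry)
    fun _ _ f x t => ContinuousMap.ext fun s => prismMap_map K f x t s
  let path (z : nerveRealization C) : C(unitInterval, nerveRealization D) := H z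
  have hpath : Continuous path := H.hom.continuous
  have hend (ε : Fin 2) (z : nerveRealization C) :
      path z (stdSimplexHomeomorphUnitInterval (stdSimplex.vertex ε)) =
        SSet.toTop.map (nerveMap (K.obj ε)) z := by
    let ev : TopCat.of C(unitInterval, nerveRealization D) ⟶ nerveRealization D :=
      TopCat.ofHom ⟨fun c => c (stdSimplexHomeomorphUnitInterval (stdSimplex.vertex ε)),
        continuous_eval_const _⟩
    have h : H ≫ ev = SSet.toTop.map (nerveMap (K.obj ε)) := toTop_hom_ext fun n x t =>
      (DFunLike.congr_fun (hH n x t) _).trans (prismMap_vertex K x t ε)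
    exact ConcreteCategory.congr_hom h z
  refine ⟨⟨⟨fun z => path z.2 z.1, ?_⟩, fun z => ?_, fun z => ?_⟩⟩
  · exact continuous_eval.comp ((hpath.comp continuous_snd).prodMk continuous_fst)
  · exact (congrArg (path z) stdSimplexHomeomorphUnitInterval_zero).symm.trans (hend 0 z)
  · exact (congrArg (path z) stdSimplexHomeomorphUnitInterval_one).symm.trans (hend 1 z)

theorem nerveMap_const_nullhomotopic (d : D) :
    (SSet.toTop.map (nerveMap ((Functor.const C).obj d))).hom.Nullhomotopic := by
  let y : (nerve D) _⦋0⦌ := ComposableArrows.mk₀ d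
  let p : nerveRealization D := charMap y (default : stdSimplex ℝ (Fin 1))
  have hconst : SSet.toTop.map (nerveMap ((Functor.const C).obj d)) =
      TopCat.ofHom (ContinuousMap.const _ p) := toTop_hom_ext fun n x t => by
    let f : ⦋n⦌ ⟶ ⦋0⦌ := SimplexCategory.mkHom ⟨fun _ => 0, fun _ _ _ => le_rfl⟩
    have hy : (nerveMap ((Functor.const C).obj d)).app _ x = (nerve D).map f.op y :=
      CategoryTheory.Functor.ext (fun _ => rfl) fun i j k =>
        ((Category.id_comp _).trans (Category.comp_id _)).symm
    rw [toTop_map_charMap, hy, charMap_map]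
    exact congrArg (charMap y) (Subsingleton.elim (α := stdSimplex ℝ (Fin 1)) _ _)
  rw [hconst]
  exact ContinuousMap.nullhomotopic_of_constant p

theorem contractibleSpace_nerveRealization (T : C ⥤ C) (η : 𝟭 C ⟶ T) (c : C)
    (θ : (Functor.const C).obj c ⟶ T) : ContractibleSpace (nerveRealization C) := by
  rw [contractible_iff_id_nullhomotopic]
  have hid : (SSet.toTop.map (nerveMap (𝟭 C))).hom = ContinuousMap.id (nerveRealization C) :=
    congrArg TopCat.Hom.hom (SSet.toTop.map_id (nerve C))
  obtain ⟨p, hp⟩ := nerveMap_const_nullhomotopic (C := C) c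
  refine ⟨p, ?_⟩
  rw [← hid]
  exact ((homotopic_of_natTrans η).trans (homotopic_of_natTrans θ).symm).trans hp

theorem contractibleSpace_nerveRealization_of_hasInitial [Limits.HasInitial C] :
    ContractibleSpace (nerveRealization C) :=
  contractibleSpace_nerveRealization (𝟭 C) (𝟙 _) (⊥_ C) { app := fun X => Limits.initial.to X }

end NaturalTransformation

/-! ### Extensions of automorphisms -/

section ExtendsAut

variable {S : Type u} [Group S] {P Q R T : Subgroup S}

theorem mem_homImage {φ : P →* Q} {y : S} : y ∈ homImage φ ↔ ∃ x, (φ x : S) = y :=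
  ⟨fun ⟨_, ⟨x, rfl⟩, hxy⟩ => ⟨x, hxy⟩, fun ⟨x, hxy⟩ => ⟨_, ⟨x, rfl⟩, hxy⟩⟩

theorem homImage_eq_self {φ : P →* Q} {α : MulAut P} (h : ∀ g, (φ g : S) = α g) :
    homImage φ = P := by
  ext y
  refine mem_homImage.trans ⟨?_, fun hy => ⟨α.symm ⟨y, hy⟩, ?_⟩⟩
  · rintro ⟨g, rfl⟩
    exact h g ▸ (α g).2
  · rw [h, MulEquiv.apply_symm_apply]

theorem exists_normalizerMonoidHom_eq {β : MulAut P} {z : S} (h : ∀ g : P, z * g * z⁻¹ = β g) :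
    ∃ hz : z ∈ Subgroup.normalizer (P : Set S), P.normalizerMonoidHom ⟨z, hz⟩ = β := by
  have hz : z ∈ Subgroup.normalizer (P : Set S) := by
    refine Subgroup.mem_normalizer_iff.2 fun x =>
      ⟨fun hx => h ⟨x, hx⟩ ▸ (β ⟨x, hx⟩).2, fun hx => ?_⟩
    obtain ⟨g, hg⟩ := β.surjective ⟨_, hx⟩
    have hgx : z * g * z⁻¹ = z * x * z⁻¹ := by rw [h, hg]
    exact mul_left_cancel (mul_right_cancel hgx) ▸ g.2
  exact ⟨hz, MulEquiv.ext fun g => Subtype.ext (h g)⟩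

theorem normalizerMonoidHom_of_mem (x : P) :
    P.normalizerMonoidHom ⟨x, Subgroup.le_normalizer x.2⟩ = MulAut.conj x := by
  ext g
  rfl

theorem innerAut_le_autS (P : Subgroup S) : innerAut P ≤ autS P := by
  rintro _ ⟨x, rfl⟩
  exact ⟨_, normalizerMonoidHom_of_mem x⟩

/-- The homomorphism `φ : Q → R` extends the automorphism `α` of the subgroup `P ≤ Q`. The values
are compared in `S`, so that `P ≤ R` need not be known in advance. -/
def ExtendsAut (φ : Q →* R) (h : P ≤ Q) (α : MulAut P) : Prop :=
  ∀ g : P, (φ (Subgroup.inclusion h g) : S) = α g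

theorem extendsAut_iff_homRestrict_eq {φ : Q →* R} {hQ : P ≤ Q} {hR : P ≤ R} {α : MulAut P} :
    ExtendsAut φ hQ α ↔ homRestrict φ hQ = (Subgroup.inclusion hR).comp α.toMonoidHom := by
  rw [DFunLike.ext_iff]
  exact forall_congr' fun _ => ⟨fun h => Subtype.ext h, congrArg Subtype.val⟩

theorem extendsAut_inclusion (hQ : P ≤ Q) (hQR : Q ≤ R) :
    ExtendsAut (Subgroup.inclusion hQR) hQ 1 :=
  fun _ => rfl

namespace ExtendsAut

variable {φ : Q →* R} {hQ : P ≤ Q} {hR : P ≤ R} {α β : MulAut P}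

theorem homImage_eq (hφ : ExtendsAut φ hQ α) : homImage (homRestrict φ hQ) = P :=
  homImage_eq_self hφ

theorem apply_inclusion (hφ : ExtendsAut φ hQ α) (g : P) :
    φ (Subgroup.inclusion hQ g) = Subgroup.inclusion hR (α g) :=
  Subtype.ext (hφ g)

theorem comp (hφ : ExtendsAut φ hQ α) {ψ : R →* T} (hψ : ExtendsAut ψ hR β) :
    ExtendsAut (ψ.comp φ) hQ (β * α) := fun g => by
  rw [MonoidHom.comp_apply, hφ.apply_inclusion (hR := hR), hψ, MulAut.mul_apply]

theorem of_comp (hφ : ExtendsAut φ hQ α) {ψ : R →* T}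
    (hψφ : ExtendsAut (ψ.comp φ) hQ (β * α)) : ExtendsAut ψ hR β := fun g => by
  have hg := hψφ (α⁻¹ g)
  rwa [MonoidHom.comp_apply, hφ.apply_inclusion (hR := hR), MulAut.mul_apply,
    MulAut.apply_inv_self] at hg

theorem eq_of_le (hQP : Q ≤ P) {ψ : Q →* R} (hφ : ExtendsAut φ hQ α) (hψ : ExtendsAut ψ hQ α) :
    φ = ψ :=
  MonoidHom.ext fun x => Subtype.ext ((hφ ⟨x, hQP x.2⟩).trans (hψ ⟨x, hQP x.2⟩).symm)

theorem range_eq_of_le (hQP : Q ≤ P) (hφ : ExtendsAut φ hQ α) : φ.range = P.subgroupOf R := by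
  ext y
  rw [MonoidHom.mem_range, Subgroup.mem_subgroupOf]
  refine ⟨?_, fun hy => ⟨Subgroup.inclusion hQ (α.symm ⟨y, hy⟩), Subtype.ext ?_⟩⟩
  · rintro ⟨x, rfl⟩
    exact hφ ⟨x, hQP x.2⟩ ▸ (α ⟨x, hQP x.2⟩).2
  · rw [hφ, MulEquiv.apply_symm_apply]

theorem normalizerMonoidHom_apply (hφ : ExtendsAut φ hQ α) {y : Q}
    (hy : (y : S) ∈ Subgroup.normalizer (P : Set S)) :
    ∃ hz : (φ y : S) ∈ Subgroup.normalizer (P : Set S),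
      P.normalizerMonoidHom ⟨φ y, hz⟩ = α * P.normalizerMonoidHom ⟨y, hy⟩ * α⁻¹ := by
  refine exists_normalizerMonoidHom_eq fun g => ?_
  obtain ⟨g, rfl⟩ := α.surjective g
  have hconj : Subgroup.inclusion hQ (P.normalizerMonoidHom ⟨y, hy⟩ g) =
      y * Subgroup.inclusion hQ g * y⁻¹ := rfl
  rw [MulAut.mul_apply, MulAut.mul_apply, MulAut.inv_apply_self, ← hφ, ← hφ, hconj]
  simp only [map_mul, map_inv, Subgroup.coe_mul, Subgroup.coe_inv]

end ExtendsAut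

/-- For `α ∈ Aut(P)`, the group of those `y ∈ N_S(P)` such that `α c_y α⁻¹` is conjugation by an
element of `R`. For `R = S` this is the group `N_α`; the extension of `α` to a subgroup of it can be
chosen with values in `R`, if `R` contains `P` and `P` contains its centralizer. -/
def relExtensionGroup (α : MulAut P) (R : Subgroup S) : Subgroup S :=
  Subgroup.map (Subgroup.normalizer (P : Set S)).subtype
    (((R.subgroupOf (Subgroup.normalizer (P : Set S))).map P.normalizerMonoidHom).comap
      ((MulAut.conj α).toMonoidHom.comp P.normalizerMonoidHom))

theorem mem_relExtensionGroup {α : MulAut P} {y : S} :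
    y ∈ relExtensionGroup α R ↔ ∃ hy : y ∈ Subgroup.normalizer (P : Set S),
      ∃ z : Subgroup.normalizer (P : Set S), (z : S) ∈ R ∧
        P.normalizerMonoidHom z = α * P.normalizerMonoidHom ⟨y, hy⟩ * α⁻¹ := by
  simp only [relExtensionGroup, Subgroup.mem_map, Subgroup.mem_comap, Subgroup.mem_subgroupOf]
  exact ⟨fun ⟨x, ⟨z, hz, hzx⟩, hx⟩ => hx ▸ ⟨x.2, z, hz, hzx⟩,
    fun ⟨hy, z, hz, hzy⟩ => ⟨⟨y, hy⟩, ⟨z, hz, hzy⟩, rfl⟩⟩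

theorem relExtensionGroup_le (α : MulAut P) (R : Subgroup S) :
    relExtensionGroup α R ≤ autExtensionGroup P α := fun _ hy =>
  let ⟨hyN, z, _, hz⟩ := mem_relExtensionGroup.1 hy
  mem_autExtensionGroup.2 ⟨hyN, z, hz⟩

theorem relExtensionGroup_mono (α : MulAut P) (h : R ≤ T) :
    relExtensionGroup α R ≤ relExtensionGroup α T := fun _ hy =>
  let ⟨hyN, z, hzR, hz⟩ := mem_relExtensionGroup.1 hy
  mem_relExtensionGroup.2 ⟨hyN, z, h hzR, hz⟩

theorem le_relExtensionGroup (α : MulAut P) (hR : P ≤ R) : P ≤ relExtensionGroup α R := by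
  intro x hx
  refine mem_relExtensionGroup.2 ⟨Subgroup.le_normalizer hx,
    ⟨α ⟨x, hx⟩, Subgroup.le_normalizer (α ⟨x, hx⟩).2⟩, hR (α ⟨x, hx⟩).2, ?_⟩
  rw [normalizerMonoidHom_of_mem, normalizerMonoidHom_of_mem ⟨x, hx⟩]
  ext g
  simp [MulAut.conj_apply]

theorem ExtendsAut.mem_relExtensionGroup {φ : Q →* R} {hQ : P ≤ Q} {α : MulAut P}
    (hφ : ExtendsAut φ hQ α) {y : Q} (hy : (y : S) ∈ Subgroup.normalizer (P : Set S))
    (hT : (φ y : S) ∈ T) : (y : S) ∈ relExtensionGroup α T :=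
  let ⟨hz, hzy⟩ := hφ.normalizerMonoidHom_apply hy
  _root_.mem_relExtensionGroup.2 ⟨hy, ⟨φ y, hz⟩, hT, hzy⟩

end ExtendsAut

namespace FusionSystem

variable {S : Type u} [Group S] {F : FusionSystem S} {P : Subgroup S}

theorem exists_mulEquiv_of_homImage_eq {A B C : Subgroup S} {φ : A →* B} (hφ : φ ∈ F.Hom A B)
    (hC : homImage φ = C) : ∃ e : A ≃* C, e.toMonoidHom ∈ F.Hom A C ∧
      e.symm.toMonoidHom ∈ F.Hom C A ∧ ∀ x, (e x : S) = φ x := by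
  obtain ⟨R, hR, e, he, he', rfl⟩ := F.factor hφ
  obtain rfl : R = C := by
    rw [← hC]
    ext y
    refine Iff.trans ⟨fun hy => ?_, ?_⟩ mem_homImage.symm
    · exact ⟨e.symm ⟨y, hy⟩, congrArg Subtype.val (e.apply_symm_apply ⟨y, hy⟩)⟩
    · rintro ⟨x, rfl⟩
      exact (e x).2
  exact ⟨e, he, he', fun _ => rfl⟩

theorem exists_corestrict {A B C : Subgroup S} {φ : A →* B} (hφ : φ ∈ F.Hom A B)
    (h : ∀ x, (φ x : S) ∈ C) : ∃ ψ ∈ F.Hom A C, ∀ x, (ψ x : S) = φ x := by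
  obtain ⟨e, he, -, heφ⟩ := exists_mulEquiv_of_homImage_eq hφ rfl
  have hC : homImage φ ≤ C := fun y hy => by
    obtain ⟨x, rfl⟩ := mem_homImage.1 hy
    exact h x
  exact ⟨_, F.comp_mem he (F.inclusion_mem hC), heφ⟩

theorem exists_extendsAut_of_homImage_eq {A B : Subgroup S} {φ : A →* B} (hφ : φ ∈ F.Hom A B)
    (h : P ≤ A) (him : homImage (homRestrict φ h) = P) : ∃ α ∈ F.aut P, ExtendsAut φ h α := by
  obtain ⟨e, he, he', heφ⟩ :=
    exists_mulEquiv_of_homImage_eq (F.comp_mem (F.inclusion_mem h) hφ) him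
  exact ⟨e, ⟨he, he'⟩, fun g => (heφ g).symm⟩

theorem mem_tilde {y : S} : y ∈ F.tilde P ↔ ∃ hy : y ∈ Subgroup.normalizer (P : Set S),
    ∀ α ∈ F.aut P, α * P.normalizerMonoidHom ⟨y, hy⟩ * α⁻¹ ∈ autS P := by
  refine ⟨fun h => ⟨F.tilde_le_normalizer P h, fun α hα => ?_⟩, fun ⟨hy, h⟩ => ?_⟩
  · exact (mem_autExtensionGroup.1 (iInf₂_le (f := fun α _ => autExtensionGroup P α) α hα h)).2
  · simp only [tilde, Subgroup.mem_iInf]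
    exact fun α hα => mem_autExtensionGroup.2 ⟨hy, h α hα⟩

theorem tilde_le_relExtensionGroup {α : MulAut P} (hα : α ∈ F.aut P) {R : Subgroup S}
    (hR : F.tilde P ≤ R) : F.tilde P ≤ relExtensionGroup α R := fun y hy => by
  obtain ⟨hyN, hyα⟩ := mem_tilde.1 hy
  obtain ⟨z, hz⟩ := hyα α hα
  refine mem_relExtensionGroup.2 ⟨hyN, z, hR (mem_tilde.2 ⟨z.2, fun β hβ => ?_⟩), hz⟩
  have hβα := hyα (β * α) (mul_mem hβ hα)
  rw [hz]
  simpa only [mul_assoc, mul_inv_rev] using hβα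

theorem mem_autS_of_mk_mem_outS {a : F.aut P} (ha : (a : F.Out P) ∈ F.outS P) :
    (a : MulAut P) ∈ autS P := by
  obtain ⟨b, hb, hba⟩ := ha
  have hinner : b⁻¹ * a ∈ (autS P).subgroupOf (F.aut P) :=
    innerAut_le_autS P (QuotientGroup.eq.1 hba : b⁻¹ * a ∈ (innerAut P).subgroupOf (F.aut P))
  rw [← Subgroup.mem_subgroupOf, ← mul_inv_cancel_left b a]
  exact mul_mem hb hinner

theorem mem_tilde_of_mk_mem_normal {N : Subgroup (F.Out P)} [hN : N.Normal] (hNS : N ≤ F.outS P)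
    {a : F.aut P} (ha : (a : F.Out P) ∈ N) {y : Subgroup.normalizer (P : Set S)}
    (hy : P.normalizerMonoidHom y = a) : (y : S) ∈ F.tilde P :=
  mem_tilde.2 ⟨y.2, fun α hα => hy ▸ mem_autS_of_mk_mem_outS
    (hNS (hN.conj_mem _ ha ((⟨α, hα⟩ : F.aut P) : F.Out P)))⟩

namespace IsSaturated

variable {p : ℕ}

theorem exists_extendsAut (hF : F.IsSaturated p) (hn : F.IsFullyNormalized p P) {α : MulAut P}
    (hα : α ∈ F.aut P) {Q : Subgroup S} (hPQ : P ≤ Q) (hQ : Q ≤ autExtensionGroup P α) :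
    ∃ ψ ∈ F.Hom Q ⊤, ExtendsAut ψ hPQ α := by
  let φ : P →* (⊤ : Subgroup S) := (Subgroup.inclusion le_top).comp α.toMonoidHom
  have him : homImage φ = P := homImage_eq_self (α := α) fun _ => rfl
  have hQφ : Q ≤ homExtensionGroup φ := fun y hy => by
    obtain ⟨hyN, z, hz⟩ := mem_autExtensionGroup.1 (hQ hy)
    refine ⟨⟨y, hyN⟩, ⟨_, ⟨⟨z, him.symm ▸ z.2⟩, rfl⟩, fun x => ?_⟩, rfl⟩
    have hx : P.normalizerMonoidHom z (α x) = α (P.normalizerMonoidHom ⟨y, hyN⟩ x) := by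
      rw [hz, MulAut.mul_apply, MulAut.mul_apply, MulAut.inv_apply_self]
    exact (congrArg Subtype.val hx).symm
  obtain ⟨ψ, hψ, _, hψφ⟩ := hF.extend P φ (F.comp_mem hα.1 (F.inclusion_mem le_top))
    (him.symm ▸ (hF.sylow P hn).1)
  exact ⟨ψ.comp (Subgroup.inclusion hQφ), F.comp_mem (F.inclusion_mem hQφ) hψ,
    fun g => congrArg Subtype.val (DFunLike.congr_fun hψφ g)⟩

theorem exists_extendsAut_to (hF : F.IsSaturated p) (hn : F.IsFullyNormalized p P)
    {α : MulAut P} (hα : α ∈ F.aut P) {Q R : Subgroup S} (hPQ : P ≤ Q)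
    (hR : Subgroup.centralizer (P : Set S) ≤ R) (hQ : Q ≤ relExtensionGroup α R) :
    ∃ ψ ∈ F.Hom Q R, ExtendsAut ψ hPQ α := by
  obtain ⟨ψ, hψ, hψα⟩ := hF.exists_extendsAut hn hα hPQ (hQ.trans (relExtensionGroup_le _ _))
  have hψR : ∀ y, (ψ y : S) ∈ R := fun y => by
    obtain ⟨hyN, z, hzR, hz⟩ := mem_relExtensionGroup.1 (hQ y.2)
    obtain ⟨hψN, hψz⟩ := hψα.normalizerMonoidHom_apply hyN
    have hker : z⁻¹ * ⟨ψ y, hψN⟩ ∈ P.normalizerMonoidHom.ker := by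
      rw [MonoidHom.mem_ker, map_mul, map_inv, hz, hψz, inv_mul_cancel]
    rw [Subgroup.normalizerMonoidHom_ker, Subgroup.mem_subgroupOf] at hker
    simpa using mul_mem hzR (hR hker)
  obtain ⟨χ, hχ, hχψ⟩ := exists_corestrict hψ hψR
  exact ⟨χ, hχ, fun g => (hχψ _).trans (hψα g)⟩

theorem isGreatest_tilde (hF : F.IsSaturated p) (hn : F.IsFullyNormalized p P) :
    IsGreatest {Q : Subgroup S | Q ≤ Subgroup.normalizer (P : Set S) ∧
        ∃ h : P ≤ Q, ∀ α ∈ F.aut P, ∃ ψ ∈ F.Hom Q ⊤,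
          homRestrict ψ h = (Subgroup.inclusion le_top).comp α.toMonoidHom} (F.tilde P) := by
  simp only [← extendsAut_iff_homRestrict_eq]
  refine ⟨⟨F.tilde_le_normalizer P, F.le_tilde P, fun α hα =>
    hF.exists_extendsAut hn hα _ (iInf₂_le α hα)⟩, ?_⟩
  rintro Q ⟨hQN, hPQ, hQ⟩
  refine le_iInf₂ fun α hα y hy => ?_
  obtain ⟨ψ, -, hψ⟩ := hQ α hα
  exact relExtensionGroup_le α ⊤ (hψ.mem_relExtensionGroup (y := ⟨y, hy⟩) (hQN hy) trivial)

theorem lt_tilde (hF : F.IsSaturated p) (hn : F.IsFullyNormalized p P)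
    (hr : ¬ F.IsRadical p P) : P < F.tilde P := by
  obtain ⟨-, -, T, hT⟩ := hF.sylow P hn
  simp only [IsRadical, not_forall] at hr
  obtain ⟨N, hN, hNp, hN1⟩ := hr
  have hNS : N ≤ F.outS P := hT ▸ hNp.le_sylow_of_normal T
  obtain ⟨n, hnN, hn1⟩ := N.bot_or_exists_ne_one.resolve_left hN1
  obtain ⟨a, ⟨y, hy⟩, rfl⟩ := hNS hnN
  have hyP : (y : S) ∉ P := fun hyP =>
    hn1 ((QuotientGroup.eq_one_iff a).2 ⟨⟨y, hyP⟩, (normalizerMonoidHom_of_mem _).symm.trans hy⟩)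
  exact (F.le_tilde P).lt_of_not_ge fun hle =>
    hyP (hle (mem_tilde_of_mk_mem_normal hNS hnN hy))

end IsSaturated

end FusionSystem

/-! ### Morphisms of linking systems -/

namespace FusionSystem.CentricLinkingSystem

variable {S : Type u} [Group S] {F : FusionSystem S}

section Linking

variable (L : F.CentricLinkingSystem)

/-- The distinguished monomorphism `δ_X : X → Aut_L(X)`, for `X` in the type synonym that carries
the category structure of `L`. -/
def distHom (X : L.Obj) : X.toSubgroup →* Aut X := L.dist X

/-- The distinguished endomorphism `δ_X(g)` of the object `X` of a linking system. -/
def delta (X : L.Obj) (g : X.toSubgroup) : X ⟶ X := (L.distHom X g).hom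

theorem delta_one (X : L.Obj) : L.delta X 1 = 𝟙 X :=
  congrArg Iso.hom (map_one (L.distHom X))

theorem delta_mul (X : L.Obj) (g h : X.toSubgroup) :
    L.delta X (g * h) = L.delta X h ≫ L.delta X g :=
  congrArg Iso.hom (map_mul (L.distHom X) g h)

variable {L} {X Y Z : L.Obj}

theorem map_delta (g x : X.toSubgroup) : L.map (L.delta X g) x = g * x * g⁻¹ :=
  DFunLike.congr_fun (L.proj_dist X g) x

theorem comp_delta (f : X ⟶ Y) (g : X.toSubgroup) :
    f ≫ L.delta Y (L.map f g) = L.delta X g ≫ f :=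
  L.comm f g

theorem map_eq_iff (f g : X ⟶ Y) :
    L.map f = L.map g ↔ ∃ z ∈ Subgroup.center X.toSubgroup, g = L.delta X z ≫ f :=
  L.proj_eq_iff f g

theorem eq_one_of_delta_comp {f : X ⟶ Y} {z : X.toSubgroup}
    (hz : z ∈ Subgroup.center X.toSubgroup) (h : L.delta X z ≫ f = f) : z = 1 :=
  L.free f z hz h

theorem map_mem (f : X ⟶ Y) : L.map f ∈ F.Hom X.toSubgroup Y.toSubgroup :=
  (L.range_proj X Y).subset ⟨f, rfl⟩

theorem exists_map_eq {φ : X.toSubgroup →* Y.toSubgroup}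
    (hφ : φ ∈ F.Hom X.toSubgroup Y.toSubgroup) : ∃ f : X ⟶ Y, L.map f = φ :=
  (L.range_proj X Y).superset hφ

theorem map_injective (f : X ⟶ Y) : Function.Injective (L.map f) := F.injective (map_mem f)

theorem map_comp_apply (f : X ⟶ Y) (g : Y ⟶ Z) (x : X.toSubgroup) :
    L.map (f ≫ g) x = L.map g (L.map f x) :=
  DFunLike.congr_fun (L.map_comp f g) x

theorem map_surjective_of_isIso (f : X ⟶ Y) [IsIso f] : Function.Surjective (L.map f) :=
  fun y => ⟨L.map (inv f) y, by rw [← map_comp_apply, IsIso.inv_hom_id, L.map_id]; rfl⟩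

instance mono_hom (g : Y ⟶ Z) : Mono g := by
  refine ⟨fun {X} h k hhk => ?_⟩
  have hmap : L.map h = L.map k := MonoidHom.ext fun x => map_injective g (by
    rw [← map_comp_apply, ← map_comp_apply, hhk])
  obtain ⟨z, hz, rfl⟩ := (map_eq_iff h k).1 hmap
  rw [Category.assoc] at hhk
  rw [eq_one_of_delta_comp hz hhk.symm, delta_one, Category.id_comp]

/-- In a linking system `Z(X)` acts freely by precomposition; here `c` acts by postcomposition, but
it centralizes the image of the centric subgroup `X`, so it is the image of an element of `Z(X)`. -/
theorem eq_one_of_comp_delta {f : X ⟶ Y} {c : Y.toSubgroup} (h : f ≫ L.delta Y c = f) :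
    c = 1 := by
  have hcomm (x) : L.map f x * c = c * L.map f x := by
    have hx : c * L.map f x * c⁻¹ = L.map f x := by
      rw [← map_delta, ← map_comp_apply, h]
    exact (mul_inv_eq_iff_eq_mul.1 hx).symm
  obtain ⟨e, he, he', -⟩ := exists_mulEquiv_of_homImage_eq (map_mem f) rfl
  have hc : (c : S) ∈ homImage (L.map f) := by
    refine CentricSubgroup.isCentric X _ ⟨e, he, he'⟩
      (Subgroup.mem_centralizer_iff.2 fun y hy => ?_)
    obtain ⟨x, rfl⟩ := mem_homImage.1 hy
    exact congrArg Subtype.val (hcomm x)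
  obtain ⟨z, hz⟩ := mem_homImage.1 hc
  obtain rfl : L.map f z = c := Subtype.ext hz
  have hzX : z ∈ Subgroup.center X.toSubgroup := Subgroup.mem_center_iff.2 fun x =>
    map_injective f (by rw [map_mul, map_mul, hcomm])
  rw [comp_delta] at h
  rw [eq_one_of_delta_comp hzX h, map_one]

theorem exists_lift (a : X ⟶ Y) (b : X ⟶ Z) {ψ : Y.toSubgroup →* Z.toSubgroup}
    (hψ : ψ ∈ F.Hom Y.toSubgroup Z.toSubgroup) (h : ψ.comp (L.map a) = L.map b) :
    ∃ k : Y ⟶ Z, a ≫ k = b ∧ ∃ y, ∀ x, L.map k x = ψ (y * x * y⁻¹) := by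
  obtain ⟨k, rfl⟩ := exists_map_eq hψ
  rw [← L.map_comp] at h
  obtain ⟨z, -, rfl⟩ := (map_eq_iff _ _).1 h
  refine ⟨L.delta Y (L.map a z) ≫ k, ?_, L.map a z, fun x => ?_⟩
  · rw [← Category.assoc, comp_delta, Category.assoc]
  · rw [map_comp_apply, map_delta]

theorem exists_comp_eq_comp_delta (k : X ⟶ Y) [hk : (L.map k).range.Normal] (x : Y.toSubgroup) :
    ∃ u : X ⟶ X, u ≫ k = k ≫ L.delta Y x := by
  obtain ⟨e, he, he', hek⟩ := exists_mulEquiv_of_homImage_eq (map_mem k) rfl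
  have hx : ∀ y ∈ homImage (L.map k), (x : S) * y * (x : S)⁻¹ ∈ homImage (L.map k) := by
    rintro _ ⟨y, hy, rfl⟩
    exact ⟨_, hk.conj_mem y hy x, rfl⟩
  obtain ⟨u, hu⟩ := exists_map_eq (L := L) (F.comp_mem (F.comp_mem he (F.conj_mem (x : S) hx)) he')
  have hmap : L.map (u ≫ k) = L.map (k ≫ L.delta Y x) := by
    ext y
    rw [map_comp_apply, map_comp_apply, map_delta, hu, ← hek, Subgroup.coe_mul, Subgroup.coe_mul,
      ← hek]
    exact congrArg Subtype.val (e.apply_symm_apply (conjHom (x : S) hx (e y)))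
  obtain ⟨z, -, hz⟩ := (map_eq_iff _ _).1 hmap
  exact ⟨L.delta X z ≫ u, by rw [Category.assoc, ← hz]⟩

theorem comp_delta_map_eq {k : X ⟶ Y} {u : X ⟶ X} {x : Y.toSubgroup}
    (hu : u ≫ k = k ≫ L.delta Y x) (h : Y ⟶ Z) :
    (k ≫ h) ≫ L.delta Z (L.map h x) = u ≫ k ≫ h := by
  rw [← Category.assoc u, hu, Category.assoc, Category.assoc, comp_delta]

theorem epi_of_range_normal (k : X ⟶ Y) [(L.map k).range.Normal] : Epi k := by
  refine ⟨fun {Z} h₁ h₂ h => ?_⟩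
  have hmap : L.map h₁ = L.map h₂ := MonoidHom.ext fun x => by
    obtain ⟨u, hu⟩ := exists_comp_eq_comp_delta k x
    have hδ : (k ≫ h₁) ≫ L.delta Z (L.map h₁ x) = (k ≫ h₁) ≫ L.delta Z (L.map h₂ x) := by
      rw [comp_delta_map_eq hu, h, comp_delta_map_eq hu]
    have hδ' : (k ≫ h₁) ≫ L.delta Z ((L.map h₁ x)⁻¹ * L.map h₂ x) = k ≫ h₁ := by
      rw [delta_mul, ← Category.assoc, ← hδ, Category.assoc, ← delta_mul, inv_mul_cancel,
        delta_one, Category.comp_id]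
    exact inv_mul_eq_one.1 (eq_one_of_comp_delta hδ')
  obtain ⟨z, -, rfl⟩ := (map_eq_iff h₁ h₂).1 hmap
  rw [← Category.assoc, cancel_mono] at h
  rw [eq_one_of_comp_delta h.symm, delta_one, Category.id_comp]

end Linking

/-! ### The undercategory of `P` in its normalizer -/

variable {L : F.CentricLinkingSystem} {P : Subgroup S} {hc : F.IsCentric P}

namespace NormalizerObj

variable {Q R : L.NormalizerObj hc}

theorem le_prod (Q : L.NormalizerObj hc) : P ≤ Q.prod.toSubgroup := le_sup_right

theorem toSubgroup_le_prod (Q : L.NormalizerObj hc) : Q.toSubgroup ≤ Q.prod.toSubgroup :=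
  le_sup_left

theorem prod_le_normalizer (Q : L.NormalizerObj hc) :
    Q.prod.toSubgroup ≤ Subgroup.normalizer (P : Set S) :=
  sup_le Q.le_normalizer Subgroup.le_normalizer

theorem base_prod_le : (L.normalizerBase hc).prod.toSubgroup ≤ P := (sup_idem P).le

theorem Hom.exists_extendsAut (f : Q ⟶ R) :
    ∃ α ∈ F.aut P, ExtendsAut (L.map f.hom) Q.le_prod α :=
  exists_extendsAut_of_homImage_eq (map_mem f.hom) Q.le_prod f.image_eq

theorem Hom.map_mem_toSubgroup (f : Q ⟶ R) {x : Q.prod.toSubgroup} (hx : (x : S) ∈ Q.toSubgroup) :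
    (L.map f.hom x : S) ∈ R.toSubgroup := by
  obtain ⟨ψ, -, hψ⟩ := f.restrict_mem
  exact Set.mem_of_eq_of_mem (congrArg Subtype.val (DFunLike.congr_fun hψ ⟨x, hx⟩)) (ψ ⟨x, hx⟩).2

theorem Hom.extendsAut_comp {T : L.NormalizerObj hc} {f : Q ⟶ R} {g : R ⟶ T} {α β : MulAut P}
    (hf : ExtendsAut (L.map f.hom) Q.le_prod α) (hg : ExtendsAut (L.map g.hom) R.le_prod β) :
    ExtendsAut (L.map (f ≫ g).hom) Q.le_prod (β * α) := by
  have := hf.comp hg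
  rwa [← L.map_comp] at this

theorem Hom.le_relExtensionGroup {f : Q ⟶ R} {α : MulAut P}
    (hf : ExtendsAut (L.map f.hom) Q.le_prod α) :
    Q.toSubgroup ≤ relExtensionGroup α R.toSubgroup := fun x hx =>
  hf.mem_relExtensionGroup (y := ⟨x, Q.toSubgroup_le_prod hx⟩) (Q.le_normalizer hx)
    (Hom.map_mem_toSubgroup f hx)

theorem exists_hom_of_extendsAut (k : Q.prod ⟶ R.prod) {α : MulAut P}
    (hk : ∀ x : Q.prod.toSubgroup, (x : S) ∈ Q.toSubgroup → (L.map k x : S) ∈ R.toSubgroup)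
    (hα : ExtendsAut (L.map k) Q.le_prod α) : ∃ f : Q ⟶ R, f.hom = k := by
  obtain ⟨θ, hθ, hθk⟩ := exists_corestrict (C := R.toSubgroup)
    (F.comp_mem (F.inclusion_mem Q.toSubgroup_le_prod) (map_mem k)) fun x => hk _ x.2
  have hres : homRestrict (L.map k) Q.toSubgroup_le_prod =
      (Subgroup.inclusion R.toSubgroup_le_prod).comp θ :=
    MonoidHom.ext fun x => Subtype.ext (hθk x).symm
  exact ⟨⟨k, ⟨θ, ⟨hθ, L.map k, map_mem k, hres, hα.homImage_eq⟩, hres⟩, hα.homImage_eq⟩, rfl⟩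

theorem eq_of_comp_eq (a : L.normalizerBase hc ⟶ Q) {f g : Q ⟶ R} (h : a ≫ f = a ≫ g) :
    f = g := by
  obtain ⟨α, -, hα⟩ := Hom.exists_extendsAut a
  have : (L.map a.hom).range.Normal := by
    rw [hα.range_eq_of_le base_prod_le]
    exact Subgroup.normal_subgroupOf_of_le_normalizer Q.prod_le_normalizer
  have : Epi a.hom := epi_of_range_normal a.hom
  exact NormalizerObj.Hom.ext ((cancel_epi a.hom).1 (congrArg NormalizerObj.Hom.hom h))

theorem exists_comp_eq {p : ℕ} (hF : F.IsSaturated p) (hn : F.IsFullyNormalized p P)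
    {a : L.normalizerBase hc ⟶ Q} {b : L.normalizerBase hc ⟶ R} {α β : MulAut P}
    (hβ : β ∈ F.aut P) (ha : ExtendsAut (L.map a.hom) (le_prod _) α)
    (hb : ExtendsAut (L.map b.hom) (le_prod _) (β * α)) (hPR : P ≤ R.toSubgroup)
    (hQ : Q.toSubgroup ≤ relExtensionGroup β R.toSubgroup) : ∃ f : Q ⟶ R, a ≫ f = b := by
  have hcent : Subgroup.centralizer (P : Set S) ≤ R.toSubgroup :=
    (hc P ⟨MulEquiv.refl P, F.id_mem P, F.id_mem P⟩).trans hPR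
  obtain ⟨χ, hχ, hχβ⟩ := hF.exists_extendsAut_to hn hβ Q.le_prod hcent
    (sup_le hQ (le_relExtensionGroup β hPR))
  let ψ : Q.prod.toSubgroup →* R.prod.toSubgroup :=
    (Subgroup.inclusion R.toSubgroup_le_prod).comp χ
  have hψβ : ExtendsAut ψ Q.le_prod β := hχβ
  obtain ⟨k, hk, y, hkψ⟩ := exists_lift a.hom b.hom
    (F.comp_mem hχ (F.inclusion_mem R.toSubgroup_le_prod)) ((ha.comp hψβ).eq_of_le base_prod_le hb)
  have hkR : ∀ x, (L.map k x : S) ∈ R.toSubgroup := fun x => by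
    rw [hkψ]
    exact (χ _).2
  have hkβ : ExtendsAut (L.map k) Q.le_prod β :=
    ha.of_comp (by rwa [← L.map_comp, hk])
  obtain ⟨f, rfl⟩ := exists_hom_of_extendsAut k (fun x _ => hkR x) hkβ
  exact ⟨f, NormalizerObj.Hom.ext hk⟩

theorem exists_inclusion (h : Q.toSubgroup ≤ R.toSubgroup) :
    ∃ i : Q ⟶ R, ExtendsAut (L.map i.hom) Q.le_prod 1 := by
  have hle : Q.prod.toSubgroup ≤ R.prod.toSubgroup := sup_le_sup_right h P
  obtain ⟨k, hk⟩ := exists_map_eq (F.inclusion_mem hle)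
  have hk1 : ExtendsAut (L.map k) Q.le_prod 1 := hk ▸ extendsAut_inclusion Q.le_prod hle
  obtain ⟨i, rfl⟩ := exists_hom_of_extendsAut k (fun x hx => hk ▸ h hx) hk1
  exact ⟨i, hk1⟩

theorem not_isIso_of_not_le (a : L.normalizerBase hc ⟶ R) (hR : ¬ R.toSubgroup ≤ P) :
    ¬ IsIso ((L.toLinking hc).map a) := by
  intro hiso
  have : IsIso a.hom := hiso
  obtain ⟨α, -, hα⟩ := Hom.exists_extendsAut a
  have htop : P.subgroupOf R.prod.toSubgroup = ⊤ := by
    rw [← hα.range_eq_of_le base_prod_le]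
    exact MonoidHom.range_eq_top.2 (map_surjective_of_isIso a.hom)
  exact hR (R.toSubgroup_le_prod.trans (Subgroup.subgroupOf_eq_top.1 htop))

/-- The subgroup `Q P̃`, as an object of `N_L(P)`. -/
def joinTilde (Q : L.NormalizerObj hc) : L.NormalizerObj hc :=
  ⟨Q.toSubgroup ⊔ F.tilde P, sup_le Q.le_normalizer (F.tilde_le_normalizer P),
    (hc.of_le ((F.le_tilde P).trans le_sup_right)).isNormalizerCentric⟩

theorem le_joinTilde (Q : L.NormalizerObj hc) : P ≤ Q.joinTilde.toSubgroup :=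
  (F.le_tilde P).trans le_sup_right

/-- A lift to `N_L(P)` of the inclusion of `Q` in `Q P̃`. -/
noncomputable def toJoinTilde (Q : L.NormalizerObj hc) : Q ⟶ Q.joinTilde :=
  (exists_inclusion (Q := Q) (R := Q.joinTilde) le_sup_left).choose

theorem extendsAut_toJoinTilde (Q : L.NormalizerObj hc) :
    ExtendsAut (L.map Q.toJoinTilde.hom) Q.le_prod 1 :=
  (exists_inclusion (Q := Q) (R := Q.joinTilde) le_sup_left).choose_spec

theorem extendsAut_comp_toJoinTilde {f : Q ⟶ R} {α : MulAut P}
    (hf : ExtendsAut (L.map f.hom) Q.le_prod α) :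
    ExtendsAut (L.map (f ≫ R.toJoinTilde).hom) Q.le_prod α :=
  one_mul α ▸ Hom.extendsAut_comp hf R.extendsAut_toJoinTilde

theorem exists_joinTilde_comp_eq {p : ℕ} (hF : F.IsSaturated p) (hn : F.IsFullyNormalized p P)
    (a : L.normalizerBase hc ⟶ Q) (k : Q ⟶ R) :
    ∃ f : Q.joinTilde ⟶ R.joinTilde, (a ≫ Q.toJoinTilde) ≫ f = (a ≫ k) ≫ R.toJoinTilde := by
  obtain ⟨α, -, ha⟩ := Hom.exists_extendsAut a
  obtain ⟨β, hβ, hk⟩ := Hom.exists_extendsAut k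
  refine exists_comp_eq hF hn hβ (extendsAut_comp_toJoinTilde ha)
    (extendsAut_comp_toJoinTilde (Hom.extendsAut_comp ha hk)) R.le_joinTilde (sup_le ?_ ?_)
  · exact (Hom.le_relExtensionGroup hk).trans (relExtensionGroup_mono β le_sup_left)
  · exact tilde_le_relExtensionGroup hβ le_sup_right

variable (L hc) in
/-- A lift to `N_L(P)` of the inclusion of `P` in `P̃`. -/
noncomputable def baseToTilde : L.normalizerBase hc ⟶ L.normalizerTilde hc :=
  (exists_inclusion (F.le_tilde P)).choose

theorem extendsAut_baseToTilde : ExtendsAut (L.map (baseToTilde L hc).hom) (le_prod _) 1 :=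
  (exists_inclusion (Q := L.normalizerBase hc) (R := L.normalizerTilde hc)
    (F.le_tilde P)).choose_spec

theorem exists_baseToTilde_comp_eq {p : ℕ} (hF : F.IsSaturated p)
    (hn : F.IsFullyNormalized p P) (a : L.normalizerBase hc ⟶ Q) :
    ∃ f : L.normalizerTilde hc ⟶ Q.joinTilde, baseToTilde L hc ≫ f = a ≫ Q.toJoinTilde := by
  obtain ⟨α, hα, ha⟩ := Hom.exists_extendsAut a
  exact exists_comp_eq hF hn hα extendsAut_baseToTilde
    ((mul_one α).symm ▸ extendsAut_comp_toJoinTilde ha) Q.le_joinTilde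
    (tilde_le_relExtensionGroup hα le_sup_right)

end NormalizerObj

namespace NonIsoUnder

instance : Quiver.IsThin (L.NonIsoUnder hc) := fun X _ => ⟨fun f g =>
  ObjectProperty.hom_ext _ (Under.UnderMorphism.ext (NormalizerObj.eq_of_comp_eq X.obj.hom
    ((Under.w f.hom).trans (Under.w g.hom).symm)))⟩

theorem nonempty_hom_of_exists {X Y : L.NonIsoUnder hc}
    (h : ∃ f : X.obj.right ⟶ Y.obj.right, X.obj.hom ≫ f = Y.obj.hom) : Nonempty (X ⟶ Y) :=
  ⟨ObjectProperty.homMk (Under.homMk h.choose h.choose_spec)⟩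

/-- The object `P → P̃`. -/
noncomputable def base (h : P < F.tilde P) : L.NonIsoUnder hc :=
  ⟨Under.mk (NormalizerObj.baseToTilde L hc), NormalizerObj.not_isIso_of_not_le _ h.not_ge⟩

/-- The object `P → Q → Q P̃` attached to `P → Q`. -/
noncomputable def join (h : P < F.tilde P) (X : L.NonIsoUnder hc) : L.NonIsoUnder hc :=
  ⟨Under.mk (X.obj.hom ≫ X.obj.right.toJoinTilde), NormalizerObj.not_isIso_of_not_le _
    fun h' => h.not_ge (le_sup_right.trans h')⟩

theorem nonempty_hom_join (h : P < F.tilde P) (X : L.NonIsoUnder hc) :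
    Nonempty (X ⟶ join h X) :=
  nonempty_hom_of_exists ⟨X.obj.right.toJoinTilde, rfl⟩

theorem nonempty_base_hom_join (h : P < F.tilde P) {p : ℕ} (hF : F.IsSaturated p)
    (hn : F.IsFullyNormalized p P) (X : L.NonIsoUnder hc) : Nonempty (base h ⟶ join h X) :=
  nonempty_hom_of_exists (NormalizerObj.exists_baseToTilde_comp_eq hF hn X.obj.hom)

theorem nonempty_join_hom_join (h : P < F.tilde P) {p : ℕ} (hF : F.IsSaturated p)
    (hn : F.IsFullyNormalized p P) {X Y : L.NonIsoUnder hc} (f : X ⟶ Y) :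
    Nonempty (join h X ⟶ join h Y) := by
  obtain ⟨k, hk⟩ := NormalizerObj.exists_joinTilde_comp_eq hF hn X.obj.hom f.hom.right
  rw [Under.w] at hk
  exact nonempty_hom_of_exists ⟨k, hk⟩

/-- The functor that sends `P → Q` to `P → Q P̃`. -/
noncomputable def joinFunctor (h : P < F.tilde P) {p : ℕ} (hF : F.IsSaturated p)
    (hn : F.IsFullyNormalized p P) : L.NonIsoUnder hc ⥤ L.NonIsoUnder hc where
  obj := join h
  map f := (nonempty_join_hom_join h hF hn f).some
  map_id _ := Subsingleton.elim _ _
  map_comp _ _ := Subsingleton.elim _ _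

theorem contractibleSpace_nerveRealization (h : P < F.tilde P) {p : ℕ}
    (hF : F.IsSaturated p) (hn : F.IsFullyNormalized p P) :
    ContractibleSpace (nerveRealization (L.NonIsoUnder hc)) :=
  _root_.contractibleSpace_nerveRealization (joinFunctor h hF hn)
    { app := fun X => (nonempty_hom_join h X).some
      naturality := fun _ _ _ => Subsingleton.elim _ _ } (base h)
    { app := fun X => (nonempty_base_hom_join h hF hn X).some
      naturality := fun _ _ _ => Subsingleton.elim _ _ }

end NonIsoUnder

end FusionSystem.CentricLinkingSystem

theorem proposition4p1_general {p : ℕ} {S : Type u} [Group S]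
    (F : FusionSystem S) (hF : F.IsSaturated p) (L : FusionSystem.CentricLinkingSystem.{v} F)
    (P : Subgroup S) (hn : F.IsFullyNormalized p P) (hc : F.IsCentric P)
    (hr : ¬ F.IsRadical p P) :
    IsGreatest {Q : Subgroup S | Q ≤ Subgroup.normalizer (P : Set S) ∧
        ∃ h : P ≤ Q, ∀ α ∈ F.aut P, ∃ ψ ∈ F.Hom Q ⊤,
          homRestrict ψ h = (Subgroup.inclusion le_top).comp α.toMonoidHom} (F.tilde P) ∧
      P < F.tilde P ∧
      Nonempty (ContinuousMap.HomotopyEquiv (nerveRealization (L.NonIsoUnder hc))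
        (nerveRealization (Under (L.normalizerTilde hc)))) ∧
      Limits.HasInitial (Under (L.normalizerTilde hc)) ∧
      ContractibleSpace (nerveRealization (L.NonIsoUnder hc)) ∧
      ContractibleSpace (nerveRealization (Under (L.normalizerTilde hc))) := by
  have hlt : P < F.tilde P := hF.lt_tilde hn hr
  have hinit : Limits.HasInitial (Under (L.normalizerTilde hc)) :=
    Under.mkIdInitial.hasInitial
  have hnonIso : ContractibleSpace (nerveRealization (L.NonIsoUnder hc)) :=
    FusionSystem.CentricLinkingSystem.NonIsoUnder.contractibleSpace_nerveRealization hlt hF hn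
  have hunder : ContractibleSpace (nerveRealization (Under (L.normalizerTilde hc))) :=
    contractibleSpace_nerveRealization_of_hasInitial
  exact ⟨hF.isGreatest_tilde hn, hlt, ContractibleSpace.hequiv _ _, hinit, hnonIso, hunder⟩

theorem proposition4p1 {p : ℕ} [Fact p.Prime] {S : Type u} [Group S] (hS : IsDiscretePToral p S)
    (F : FusionSystem S) (hF : F.IsSaturated p) (L : FusionSystem.CentricLinkingSystem.{v} F)
    (P : Subgroup S) (hn : F.IsFullyNormalized p P) (hc : F.IsCentric P)
    (hr : ¬ F.IsRadical p P) :
    IsGreatest {Q : Subgroup S | Q ≤ Subgroup.normalizer (P : Set S) ∧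
        ∃ h : P ≤ Q, ∀ α ∈ F.aut P, ∃ ψ ∈ F.Hom Q ⊤,
          homRestrict ψ h = (Subgroup.inclusion le_top).comp α.toMonoidHom} (F.tilde P) ∧
      P < F.tilde P ∧
      Nonempty (ContinuousMap.HomotopyEquiv (nerveRealization (L.NonIsoUnder hc))
        (nerveRealization (Under (L.normalizerTilde hc)))) ∧
      Limits.HasInitial (Under (L.normalizerTilde hc)) ∧
      ContractibleSpace (nerveRealization (L.NonIsoUnder hc)) ∧
      ContractibleSpace (nerveRealization (Under (L.normalizerTilde hc))) :=
  proposition4p1_general F hF L P hn hc hr
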